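/- **Notation.** Fix $\chi\in C^\infty(\mathbb R^2)$ with $0\le\chi\le1$, $\operatorname{supp}\chi\subset\{2^{-1}\le|\xi|\le2\}$ and $\sum_{j\in\mathbb Z}\chi(2^{-j}\xi)=1$ for all $\xi\ne0$, and put $\Delta_jf=\mathscr F^{-1}[\chi(2^{-j}\cdot)\widehat f\,]$ for tempered distributions $f$, where $\widehat f(\xi)=\int_{\mathbb R^2}e^{-ix\cdot\xi}f(x)\,dx$ for Schwartz $f$. For $s\in\mathbb R$ and $1\le p,q\le\infty$ let $$\|f\|_{\dot B^s_{p,q}}=\Big\|\big(2^{sj}\|\Delta_jf\|_{L^p(\mathbb R^2)}\big)_{j\in\mathbb Z}\Big\|_{\ell^q(\mathbb Z)}\in[0,\infty],$$ a norm on tempered distributions modulo polynomials, and let $\dot B^s_{p,q}=\{\|f\|_{\dot B^s_{p,q}}<\infty\}$. For Schwartz vector fields $u,v:\mathbb R^2\to\mathbb R^2$ let $\operatorname{div}(u\otimes v)=\big(\sum_k\partial_k(u_kv_j)\big)_{j=1,2}$. Let $(-\Delta)^{-1}\mathbb P$ be the Fourier multiplier with matrix symbol $|\xi|^{-2}\big(\delta_{jk}-\xi_j\xi_k/|\xi|^2\big)_{j,k}$,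 where $\mathbb P=I+\nabla\operatorname{div}(-\Delta)^{-1}$ is the Helmholtz projection; the Fourier transform of $(-\Delta)^{-1}\mathbb P\operatorname{div}(u\otimes v)$ is then an integrable function. We use the conventions $2/\infty=0$ and $\infty^{-1}=0$. **Theorem.** Suppose that (i) $1\le p\le\infty$ and $1\le q<\infty$, or (ii) $2\le p\le\infty$ and $q=\infty$. Then there is a sequence $(u_N)_{N\in\mathbb N}\subset\dot B^{2/p-1}_{p,q}$ of real-valued divergence-free Schwartz vector fields on $\mathbb R^2$ such that $$\lim_{N\to\infty}\|u_N\|_{\dot B^{2/p-1}_{p,q}}=0,\qquad \liminf_{N\to\infty}\big\|(-\Delta)^{-1}\mathbb P\operatorname{div}(u_N\otimes u_N)\big\|_{\dot B^{2/p-1}_{p,q}}>0 .$$ In particular, there is no finite constant $C$ such that $$\|(-\Delta)^{-1}\mathbb P\operatorname{div}(u\otimes v)\|_{\dot B^{2/p-1}_{p,q}}\le C\,\|u\|_{\dot B^{2/p-1}_{p,q}}\|v\|_{\dot B^{2/p-1}_{p,q}}$$ for all real-valued divergence-free Schwartz vector fields $u,v\in\dot B^{2/p-1}_{p,q}$. Moreover,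 if $1\le p<2$ and $p'$ is the Hölder conjugate exponent, $1/p+1/p'=1$, then there are sequences $(u_N)_{N\in\mathbb N}\subset\dot B^{2/p-1}_{p,\infty}$ and $(v_N)_{N\in\mathbb N}\subset\dot B^{2/p'-1}_{p',\infty}$ of real-valued divergence-free Schwartz vector fields on $\mathbb R^2$ such that $$\lim_{N\to\infty}\|u_N\|_{\dot B^{2/p-1}_{p,\infty}}=\lim_{N\to\infty}\|v_N\|_{\dot B^{2/p'-1}_{p',\infty}}=0,\qquad \liminf_{N\to\infty}\big\|(-\Delta)^{-1}\mathbb P\operatorname{div}(u_N\otimes v_N)\big\|_{\dot B^{2/p-1}_{p,\infty}}>0 .$$ -/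

import Mathlib

open MeasureTheory Filter Topology
open scoped ENNReal NNReal SchwartzMap FourierTransform LineDeriv

noncomputable section

namespace StationaryNS

/-- The plane `ℝ²` with its Euclidean norm. -/
abbrev Plane : Type := EuclideanSpace ℝ (Fin 2)

/-- The space `ℂ²` with its Hermitian norm. -/
abbrev CVec : Type := EuclideanSpace ℂ (Fin 2)

/-- The standard basis vector `e_k` of the plane. -/
abbrev unitVec (k : Fin 2) : Plane := EuclideanSpace.single k 1

/-- The isometric inclusion of `ℝ²` into `ℂ²`. -/
def toC : Plane →L[ℝ] CVec :=
  LinearMap.toContinuousLinearMap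
    { toFun := fun x => WithLp.toLp 2 (fun k => (x k : ℂ))
      map_add' := fun x y => by ext k; simp
      map_smul' := fun c x => by ext k; simp }

@[simp] theorem toC_apply (x : Plane) (k : Fin 2) : toC x k = (x k : ℂ) := rfl

/-! ### Littlewood-Paley decomposition and homogeneous Besov norms -/

/-- `χ` is the Fourier transform (in the angular frequency variable) of the function `φ₀`
generating a homogeneous dyadic Littlewood-Paley partition of unity on the plane. -/
structure IsLittlewoodPaley (χ : Plane → ℝ) : Prop where
  smooth : ContDiff ℝ ((⊤ : ℕ∞) : WithTop ℕ∞) χ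
  nonneg : ∀ ξ, 0 ≤ χ ξ
  le_one : ∀ ξ, χ ξ ≤ 1
  tsupport_subset : tsupport χ ⊆ {ξ | 2⁻¹ ≤ ‖ξ‖ ∧ ‖ξ‖ ≤ 2}
  hasSum_one : ∀ ξ : Plane, ξ ≠ 0 → HasSum (fun j : ℤ => χ ((2 : ℝ) ^ (-j) • ξ)) 1

/-- The frequency localization `Δ_j T = 𝓕⁻¹[χ(2^{-j} ξ) 𝓕 T]` of a tempered distribution. Mathlib's
Fourier transform has the kernel `exp (-2 π i x · ξ)`, so the angular frequency is `2 π ξ`. -/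
def lpBlock (χ : Plane → ℝ) (j : ℤ) (T : 𝓢'(Plane, CVec)) : 𝓢'(Plane, CVec) :=
  TemperedDistribution.fourierMultiplierCLM CVec
    (fun ξ => ((χ ((2 : ℝ) ^ (-j) • (2 * Real.pi) • ξ) : ℝ) : ℂ)) T

/-- The `L^p` norm of a tempered distribution: the `L^p` norm of the function in `L^p` that
represents it, and `∞` if there is no such function. -/
def distLpNorm (p : ℝ≥0∞) (T : 𝓢'(Plane, CVec)) : ℝ≥0∞ :=
  ⨅ (g : Plane → CVec) (_ : MemLp g p volume)
    (_ : ∀ ψ : 𝓢(Plane, ℂ), T ψ = ∫ x, ψ x • g x), eLpNorm g p volume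

/-- The `ℓ^q(ℤ)` norm of a sequence of extended non-negative numbers. -/
def ellNorm (q : ℝ≥0∞) (a : ℤ → ℝ≥0∞) : ℝ≥0∞ :=
  if q = ∞ then ⨆ j, a j else (∑' j, a j ^ q.toReal) ^ (1 / q.toReal)

/-- The norm of the homogeneous Besov space `Ḃ^s_{p,q}(ℝ²)`, evaluated on a representative of a
class modulo polynomials. -/
def besovNorm (χ : Plane → ℝ) (s : ℝ) (p q : ℝ≥0∞) (T : 𝓢'(Plane, CVec)) : ℝ≥0∞ :=
  ellNorm q (fun j => (2 : ℝ≥0∞) ^ (s * (j : ℝ)) * distLpNorm p (lpBlock χ j T))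

/-- The critical regularity `2 / p - 1`, which is `-1` for `p = ∞`. -/
def critReg (p : ℝ≥0∞) : ℝ := (2 / p).toReal - 1

/-- The norm of the scaling critical space `Ḃ^{2/p-1}_{p,q}(ℝ²)`. -/
def critNorm (χ : Plane → ℝ) (p q : ℝ≥0∞) (T : 𝓢'(Plane, CVec)) : ℝ≥0∞ :=
  besovNorm χ (critReg p) p q T

/-! ### Vector fields -/

/-- A real Schwartz vector field, seen as a complex one. -/
def complexify (u : 𝓢(Plane, Plane)) : 𝓢(Plane, CVec) := u.postcompCLM toC

/-- The tempered distribution of a real Schwartz vector field. -/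
def toDist (u : 𝓢(Plane, Plane)) : 𝓢'(Plane, CVec) :=
  SchwartzMap.toTemperedDistributionCLM Plane CVec volume (complexify u)

/-- The vector field is divergence free: `∂₁ u₁ + ∂₂ u₂ = 0`. -/
def DivFree (u : 𝓢(Plane, Plane)) : Prop :=
  ∀ x, ∑ k, fderiv ℝ u x (unitVec k) k = 0

/-- The `k`-th row `u_k v` of the tensor product `u ⊗ v = (u_k v_j)_{k,j}`. -/
def tensorRow (u v : 𝓢(Plane, Plane)) (k : Fin 2) : 𝓢(Plane, Plane) :=
  SchwartzMap.pairing (ContinuousLinearMap.lsmul ℝ ℝ)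
    (u.postcompCLM (EuclideanSpace.proj k : Plane →L[ℝ] ℝ)) v

theorem tensorRow_apply (u v : 𝓢(Plane, Plane)) (k : Fin 2) (x : Plane) :
    tensorRow u v k x = u x k • v x := rfl

/-- `div (u ⊗ v)`, the vector field with components `∑ k, ∂_k (u_k v_j)`. -/
def divTensor (u v : 𝓢(Plane, Plane)) : 𝓢(Plane, Plane) :=
  ∑ k, ∂_{unitVec k} (tensorRow u v k)

/-! ### The operator `(-Δ)⁻¹ ℙ` -/

/-- The symbol `(δ_{jk} - η_j η_k / |η|²)_{jk}` of the Helmholtz projection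
`ℙ = I + ∇ div (-Δ)⁻¹` at the angular frequency `η`. -/
def helmholtzSymbol (η : Plane) (z : CVec) : CVec :=
  WithLp.toLp 2 (fun j => ∑ k,
    (((if j = k then (1 : ℝ) else 0) - η j * η k / ‖η‖ ^ 2 : ℝ) : ℂ) * z k)

/-- The symbol of `(-Δ)⁻¹ ℙ` at the angular frequency `η`. -/
def invLaplaceHelmholtzSymbol (η : Plane) (z : CVec) : CVec :=
  (((‖η‖ ^ 2)⁻¹ : ℝ) : ℂ) • helmholtzSymbol η z

/-- The Fourier transform of `(-Δ)⁻¹ ℙ div (u ⊗ v)`. -/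
def bilinearFourier (u v : 𝓢(Plane, Plane)) (ξ : Plane) : CVec :=
  invLaplaceHelmholtzSymbol ((2 * Real.pi) • ξ) (𝓕 (complexify (divTensor u v)) ξ)

theorem norm_helmholtzSymbol_le (η : Plane) (z : CVec) : ‖helmholtzSymbol η z‖ ≤ 8 * ‖z‖ := by
  have hη : ∀ j, |η j| ≤ ‖η‖ := fun j => by simpa using PiLp.norm_apply_le η j
  have hz : ∀ j, ‖z j‖ ≤ ‖z‖ := fun j => PiLp.norm_apply_le z j
  have hc : ∀ j k : Fin 2, |(if j = k then (1 : ℝ) else 0) - η j * η k / ‖η‖ ^ 2| ≤ 2 := by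
    intro j k
    have h1 : |(if j = k then (1 : ℝ) else 0)| ≤ 1 := by split_ifs <;> simp
    have h2 : |η j * η k / ‖η‖ ^ 2| ≤ 1 := by
      rw [abs_div, abs_mul, abs_of_nonneg (by positivity : 0 ≤ ‖η‖ ^ 2)]
      refine div_le_one_of_le₀ ?_ (by positivity)
      rw [sq]
      exact mul_le_mul (hη j) (hη k) (abs_nonneg _) (norm_nonneg _)
    exact (abs_sub _ _).trans (by linarith)
  have hj : ∀ j, ‖helmholtzSymbol η z j‖ ≤ 4 * ‖z‖ := by
    intro j
    have he : helmholtzSymbol η z j = ∑ k,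
        (((if j = k then (1 : ℝ) else 0) - η j * η k / ‖η‖ ^ 2 : ℝ) : ℂ) * z k := rfl
    rw [he]
    refine (norm_sum_le _ _).trans ?_
    have : ∀ k ∈ Finset.univ, ‖(((if j = k then (1 : ℝ) else 0) - η j * η k / ‖η‖ ^ 2 : ℝ) : ℂ)
        * z k‖ ≤ 2 * ‖z‖ := fun k _ => by
      rw [norm_mul, Complex.norm_real, Real.norm_eq_abs]
      exact mul_le_mul (hc j k) (hz k) (norm_nonneg _) (by norm_num)
    refine (Finset.sum_le_sum this).trans ?_
    simp
    linarith
  have hz0 := norm_nonneg z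
  rw [EuclideanSpace.norm_eq, Fin.sum_univ_two]
  refine Real.sqrt_le_iff.2 ⟨by positivity, ?_⟩
  nlinarith [hj 0, hj 1, norm_nonneg (helmholtzSymbol η z 0), norm_nonneg (helmholtzSymbol η z 1)]

theorem complexify_divTensor (u v : 𝓢(Plane, Plane)) :
    complexify (divTensor u v) = ∑ k, ∂_{unitVec k} (complexify (tensorRow u v k)) := by
  have h : ∀ w : 𝓢(Plane, Plane), ∀ m : Plane, complexify (∂_{m} w) = ∂_{m} (complexify w) := by
    intro w m
    ext1 x
    have hd : HasFDerivAt (fun y => toC (w y)) (toC.comp (fderiv ℝ w x)) x :=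
      toC.hasFDerivAt.comp x w.differentiableAt.hasFDerivAt
    have hc : ⇑(complexify w) = fun y => toC (w y) := rfl
    rw [SchwartzMap.lineDerivOp_apply_eq_fderiv, hc, hd.fderiv]
    rfl
  have hs : complexify (divTensor u v) =
      ∑ k, complexify (∂_{unitVec k} (tensorRow u v k)) := by
    simp only [complexify, divTensor, map_sum]
  rw [hs]
  exact Finset.sum_congr rfl fun k _ => h _ _

theorem norm_fourier_divTensor_le (u v : 𝓢(Plane, Plane)) (ξ : Plane) :
    ‖𝓕 (complexify (divTensor u v)) ξ‖ ≤
      2 * Real.pi * ‖ξ‖ * ∑ k, ‖𝓕 (complexify (tensorRow u v k)) ξ‖ := by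
  have h1 : 𝓕 (complexify (divTensor u v)) =
      ∑ k, 𝓕 (∂_{unitVec k} (complexify (tensorRow u v k))) := by
    rw [complexify_divTensor]
    exact map_sum (FourierTransform.fourierCLM ℂ 𝓢(Plane, CVec)) _ _
  rw [h1, sum_apply, Finset.mul_sum]
  refine (norm_sum_le _ _).trans (Finset.sum_le_sum fun k _ => ?_)
  have hg : (fun ξ : Plane => inner ℝ ξ (unitVec k)).HasTemperateGrowth := by fun_prop
  have hi : |inner ℝ ξ (unitVec k)| ≤ ‖ξ‖ := by
    simpa using abs_real_inner_le_norm ξ (unitVec k)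
  rw [SchwartzMap.fourier_lineDerivOp_eq, smul_apply,
    SchwartzMap.smulLeftCLM_apply_apply hg, norm_smul, norm_smul, Real.norm_eq_abs, ← mul_assoc]
  gcongr
  simp [abs_of_pos Real.pi_pos]

theorem measurable_bilinearFourier (u v : 𝓢(Plane, Plane)) :
    Measurable (bilinearFourier u v) := by
  have hF : Measurable (fun ξ => 𝓕 (complexify (divTensor u v)) ξ) :=
    (SchwartzMap.continuous _).measurable
  have hF' : ∀ k, Measurable (fun ξ => 𝓕 (complexify (divTensor u v)) ξ k) := fun k =>
    (EuclideanSpace.proj k : CVec →L[ℂ] ℂ).continuous.measurable.comp hF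
  have hη : ∀ k : Fin 2, Measurable (fun ξ : Plane => ((2 * Real.pi) • ξ) k) := fun k =>
    ((EuclideanSpace.proj k : Plane →L[ℝ] ℝ).continuous.comp
      (continuous_const_smul (2 * Real.pi))).measurable
  have hn : Measurable (fun ξ : Plane => ‖(2 * Real.pi) • ξ‖) :=
    (measurable_const_smul _).norm
  have he : bilinearFourier u v = fun ξ => (((‖(2 * Real.pi) • ξ‖ ^ 2)⁻¹ : ℝ) : ℂ) •
      helmholtzSymbol ((2 * Real.pi) • ξ) (𝓕 (complexify (divTensor u v)) ξ) := rfl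
  rw [he]
  have hA : Measurable (fun ξ : Plane => (((‖(2 * Real.pi) • ξ‖ ^ 2)⁻¹ : ℝ) : ℂ)) :=
    Complex.measurable_ofReal.comp (hn.pow_const 2).inv
  have hB : Measurable (fun ξ : Plane =>
      helmholtzSymbol ((2 * Real.pi) • ξ) (𝓕 (complexify (divTensor u v)) ξ)) := by
    refine (WithLp.measurable_toLp 2 (Fin 2 → ℂ)).comp (measurable_pi_lambda _ fun j => ?_)
    refine Finset.measurable_sum _ fun k _ => Measurable.mul ?_ (hF' k)
    exact Complex.measurable_ofReal.comp
      (measurable_const.sub (((hη j).mul (hη k)).div (hn.pow_const 2)))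
  exact hA.smul hB

theorem integrable_bilinearFourier (u v : 𝓢(Plane, Plane)) :
    Integrable (bilinearFourier u v) volume := by
  obtain ⟨H, hH⟩ : ∃ H : Plane → ℝ, ∀ ξ, H ξ = ∑ k, ‖𝓕 (complexify (tensorRow u v k)) ξ‖ :=
    ⟨_, fun _ => rfl⟩
  have hH0 : ∀ ξ, 0 ≤ H ξ := fun ξ => by
    rw [hH]
    exact Finset.sum_nonneg fun _ _ => norm_nonneg _
  have hHint : Integrable H volume := by
    rw [funext hH]
    exact integrable_finsetSum _ fun k _ => (SchwartzMap.integrable _).norm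
  obtain ⟨M, hM⟩ : ∃ M, ∀ ξ, H ξ ≤ M := by
    refine ⟨∑ k, SchwartzMap.seminorm ℝ 0 0 (𝓕 (complexify (tensorRow u v k))), fun ξ => ?_⟩
    rw [hH]
    exact Finset.sum_le_sum fun k _ => SchwartzMap.norm_le_seminorm ℝ _ ξ
  have hb : ∀ ξ, ‖bilinearFourier u v ξ‖ ≤ 8 * ‖ξ‖⁻¹ * H ξ := by
    intro ξ
    rcases eq_or_ne ξ 0 with rfl | hξ
    · simp [bilinearFourier, invLaplaceHelmholtzSymbol]
    have hpos : 0 < ‖ξ‖ := norm_pos_iff.2 hξ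
    have hpi : 0 < 2 * Real.pi := by positivity
    have hpi1 : 1 ≤ 2 * Real.pi := by linarith [Real.pi_gt_three]
    have hF : ‖𝓕 (complexify (divTensor u v)) ξ‖ ≤ 2 * Real.pi * ‖ξ‖ * H ξ := by
      rw [hH]
      exact norm_fourier_divTensor_le u v ξ
    have hS := norm_helmholtzSymbol_le ((2 * Real.pi) • ξ) (𝓕 (complexify (divTensor u v)) ξ)
    have hn : ‖(2 * Real.pi) • ξ‖ = 2 * Real.pi * ‖ξ‖ := by
      rw [norm_smul, Real.norm_of_nonneg hpi.le]
    have hle : ‖bilinearFourier u v ξ‖ ≤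
        ((2 * Real.pi * ‖ξ‖) ^ 2)⁻¹ * (8 * (2 * Real.pi * ‖ξ‖ * H ξ)) := by
      rw [bilinearFourier, invLaplaceHelmholtzSymbol, norm_smul, Complex.norm_real, hn,
        Real.norm_of_nonneg (by positivity)]
      exact mul_le_mul_of_nonneg_left (hS.trans (by linarith)) (by positivity)
    have h8 : 0 ≤ 8 * ‖ξ‖⁻¹ * H ξ := mul_nonneg (by positivity) (hH0 ξ)
    calc _ ≤ _ := hle
      _ = (2 * Real.pi)⁻¹ * (8 * ‖ξ‖⁻¹ * H ξ) := by field_simp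
      _ ≤ 1 * (8 * ‖ξ‖⁻¹ * H ξ) :=
          mul_le_mul_of_nonneg_right (inv_le_one_of_one_le₀ hpi1) h8
      _ = _ := one_mul _
  have hmeas := (measurable_bilinearFourier u v).aestronglyMeasurable (μ := volume)
  rw [← integrableOn_univ, ← Set.union_compl_self (Metric.ball (0 : Plane) 1)]
  refine IntegrableOn.union ?_ ?_
  · refine integrableOn_ball_of_norm_le_rpow (C := 8 * M) (α := 1) (by simp) (by simp)
      (Eventually.of_forall fun ξ => ?_) hmeas
    rw [Real.rpow_neg_one]
    refine (hb ξ).trans ?_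
    rw [mul_right_comm]
    gcongr
    exact hM ξ
  · refine Integrable.mono' (hHint.const_mul 8).integrableOn hmeas.restrict ?_
    refine (ae_restrict_iff' Metric.isOpen_ball.measurableSet.compl).2
      (Eventually.of_forall fun ξ hξ => (hb ξ).trans ?_)
    have h1 : 1 ≤ ‖ξ‖ := by simpa using hξ
    have := hH0 ξ
    calc 8 * ‖ξ‖⁻¹ * H ξ ≤ 8 * 1 * H ξ := by
          gcongr
          exact inv_le_one_of_one_le₀ h1
      _ = 8 * H ξ := by ring

/-- The tempered distribution of an integrable function. -/
def ofIntegrable {f : Plane → CVec} (hf : Integrable f volume) : 𝓢'(Plane, CVec) :=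
  (((memLp_one_iff_integrable.2 hf).toLp f : Lp CVec 1 (volume : Measure Plane)) :
    𝓢'(Plane, CVec))

/-- The bilinear term `(-Δ)⁻¹ ℙ div (u ⊗ v)`. -/
def bilinearTerm (u v : 𝓢(Plane, Plane)) : 𝓢'(Plane, CVec) :=
  𝓕⁻ (ofIntegrable (integrable_bilinearFourier u v))

end StationaryNS

end

open StationaryNS

noncomputable section

namespace StationaryNS

/-! ### Littlewood-Paley symbols -/

/-! The symbol of $(-\Delta)^{-1}\mathbb P\operatorname{div}$ is homogeneous of degree $-1$, so near
frequency zero the Fourier transform of the bilinear term behaves like this symbol applied to the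
constant matrix $M=\int u\otimes u$. A function with a transform homogeneous of degree $-1$ on the
plane is invariant under the critical rescaling $f\mapsto 2^kf(2^k\cdot)$, hence all its dyadic
blocks have the same weighted norm $2^{(2/p-1)j}\|\Delta_jf\|_{L^p}$. When $M$ is diagonal but not
scalar, the blocks of the bilinear term therefore stay bounded below as $j\to-\infty$, by a fixed
multiple of $|M_{11}-M_{22}|$. This is `exists_lowFrequency_lower_bound`. It is proved by pairing
with rescalings of one test function, using Hölder's inequality and dominated convergence.

If $q<\infty$, infinitely many blocks bounded below make the norm infinite (`critNorm_eq_top`), so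
small multiples of one fixed field $w$ suffice.

If $q=\infty$, the moments must stay fixed while the field tends to zero. Take
$u=n^{-1/2}\sum_{k<n}2^kw(2^k\cdot)$ with $\widehat w$ supported so narrowly that the summands have
disjoint spectra. Each summand has the second moments of $w$ and the cross terms vanish by Parseval,
so $M$ does not depend on $n$ (`secondMoment_superposition`). The summands occupy shifted dyadic
blocks, so the $\ell^\infty$ norm is only $O(n^{-1/2})$ (`critNorm_top_superposition_le`). The
sequence is the same for every $p$, and so it also serves as both factors in the statement with $p$
and $p'$.

The field $w=\nabla^\perp\psi$ comes from a stream function with spectrum near $\pm e_1$, where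
$|\widehat w_2|$ dominates $|\widehat w_1|$ (`exists_profile`). -/

theorem IsLittlewoodPaley.hasCompactSupport {χ : Plane → ℝ} (hχ : IsLittlewoodPaley χ) :
    HasCompactSupport χ :=
  (isCompact_closedBall (0 : Plane) 2).of_isClosed_subset (isClosed_tsupport χ)
    fun ξ hξ => by simpa using (hχ.tsupport_subset hξ).2

theorem IsLittlewoodPaley.eq_zero_of_norm_lt {χ : Plane → ℝ} (hχ : IsLittlewoodPaley χ)
    {ξ : Plane} (h : ‖ξ‖ < 2⁻¹) : χ ξ = 0 := by
  by_contra h0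
  exact absurd (hχ.tsupport_subset (subset_tsupport _ h0)).1 (not_le.2 h)

theorem IsLittlewoodPaley.eq_zero_of_lt_norm {χ : Plane → ℝ} (hχ : IsLittlewoodPaley χ)
    {ξ : Plane} (h : 2 < ‖ξ‖) : χ ξ = 0 := by
  by_contra h0
  exact absurd (hχ.tsupport_subset (subset_tsupport _ h0)).2 (not_le.2 h)

/-- The symbol of the frequency localization `Δ_j`. -/
def blockSymbol (χ : Plane → ℝ) (j : ℤ) (ξ : Plane) : ℂ :=
  ((χ ((2 : ℝ) ^ (-j) • (2 * Real.pi) • ξ) : ℝ) : ℂ)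

theorem hasTemperateGrowth_blockSymbol {χ : Plane → ℝ} (hχ : IsLittlewoodPaley χ) (j : ℤ) :
    (blockSymbol χ j).HasTemperateGrowth := by
  have h : χ.HasTemperateGrowth := hχ.hasCompactSupport.hasTemperateGrowth hχ.smooth
  have hl : (fun ξ : Plane => (2 : ℝ) ^ (-j) • (2 * Real.pi) • ξ).HasTemperateGrowth := by
    fun_prop
  exact Complex.ofRealCLM.hasTemperateGrowth.comp (h.comp hl)

/-- The frequency localization of a Schwartz field. -/
def schwartzBlock (χ : Plane → ℝ) (j : ℤ) : 𝓢(Plane, CVec) →L[ℂ] 𝓢(Plane, CVec) :=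
  SchwartzMap.fourierMultiplierCLM CVec (blockSymbol χ j)

theorem lpBlock_toDist {χ : Plane → ℝ} (hχ : IsLittlewoodPaley χ) (j : ℤ) (u : 𝓢(Plane, Plane)) :
    lpBlock χ j (toDist u) = SchwartzMap.toTemperedDistributionCLM Plane CVec volume
      (schwartzBlock χ j (complexify u)) :=
  TemperedDistribution.fourierMultiplierCLM_toTemperedDistributionCLM_eq
    (hasTemperateGrowth_blockSymbol hχ j) _

/-! ### The `L^p` norm of a tempered distribution -/

theorem distLpNorm_le (p : ℝ≥0∞) (f : 𝓢(Plane, CVec)) :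
    distLpNorm p (SchwartzMap.toTemperedDistributionCLM Plane CVec volume f) ≤
      eLpNorm f p volume :=
  iInf_le_of_le f <| iInf_le_of_le (f.memLp p) <| iInf_le_of_le
    (fun ψ => SchwartzMap.toTemperedDistributionCLM_apply_apply (μ := volume) f ψ) le_rfl

/-- Hölder's inequality for any function representing `T`; if no such function exists, the infimum
is over the empty set and equals `∞`. This is the only source of lower bounds on block norms. -/
theorem enorm_apply_div_le_distLpNorm {p p' : ℝ≥0∞} [p'.HolderTriple p 1] (T : 𝓢'(Plane, CVec))
    (ψ : 𝓢(Plane, ℂ)) : ‖T ψ‖ₑ / eLpNorm ψ p' volume ≤ distLpNorm p T := by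
  refine le_iInf fun g => le_iInf fun hg => le_iInf fun hT => ENNReal.div_le_of_le_mul' ?_
  have hH : eLpNorm (⇑ψ • g) 1 volume ≤ eLpNorm ψ p' volume * eLpNorm g p volume :=
    eLpNorm_smul_le_mul_eLpNorm hg.1 (ψ.memLp p' volume).1
  rw [eLpNorm_one_eq_lintegral_enorm] at hH
  rw [hT]
  exact (enorm_integral_le_lintegral_enorm _).trans hH

/-- The dilation pushes Lebesgue measure to a multiple of itself. Working with the measure treats
all `p` at once, since `(1 / p).toReal = 0` both at `p = ∞` and at `p = 0`. -/
theorem eLpNorm_comp_zpow_smul {E : Type*} [NormedAddCommGroup E] (f : Plane → E)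
    (p : ℝ≥0∞) (k : ℤ) :
    eLpNorm (fun x => f ((2 : ℝ) ^ k • x)) p volume =
      (2 : ℝ≥0∞) ^ (-(2 * (k : ℝ)) * (1 / p).toReal) * eLpNorm f p volume := by
  have hc : (2 : ℝ) ^ k ≠ 0 := by positivity
  have hm : MeasurableEmbedding (fun x : Plane => (2 : ℝ) ^ k • x) :=
    (Homeomorph.smulOfNeZero _ hc).measurableEmbedding
  have h1 : eLpNorm (fun x => f ((2 : ℝ) ^ k • x)) p volume =
      eLpNorm f p (Measure.map (fun x : Plane => (2 : ℝ) ^ k • x) volume) :=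
    (hm.eLpNorm_map_measure (g := f)).symm
  have h2 : ENNReal.ofReal |(((2 : ℝ) ^ k) ^ 2)⁻¹| = (2 : ℝ≥0∞) ^ (-(2 * (k : ℝ))) := by
    have h3 : (((2 : ℝ) ^ k) ^ 2)⁻¹ = (2 : ℝ) ^ (-(2 * (k : ℝ))) := by
      rw [Real.rpow_neg (by norm_num), mul_comm, Real.rpow_mul (by norm_num), Real.rpow_intCast,
        Real.rpow_ofNat]
    rw [abs_of_pos (by positivity), h3, ← ENNReal.ofReal_rpow_of_pos (by norm_num),
      ENNReal.ofReal_ofNat]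
  rw [h1, Measure.map_addHaar_smul _ hc, finrank_euclideanSpace, Fintype.card_fin, h2,
    eLpNorm_smul_measure_of_ne_zero, smul_eq_mul, ← ENNReal.rpow_mul]
  exact (ENNReal.rpow_pos (by norm_num) (by norm_num)).ne'

/-! ### Frequency localization of the bilinear term -/

/-- Testing against a Fourier transform cancels the inverse transform in `bilinearTerm`, leaving an
absolutely convergent integral on the frequency side. -/
theorem lpBlock_bilinearTerm_fourier {χ : Plane → ℝ} (hχ : IsLittlewoodPaley χ) (j : ℤ)
    (u v : 𝓢(Plane, Plane)) (φ : 𝓢(Plane, ℂ)) :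
    lpBlock χ j (bilinearTerm u v) (𝓕 φ) =
      ∫ ξ, (blockSymbol χ j ξ * φ ξ) • bilinearFourier u v ξ := by
  have h1 : lpBlock χ j (bilinearTerm u v) (𝓕 φ) = ofIntegrable (integrable_bilinearFourier u v)
      (SchwartzMap.smulLeftCLM ℂ (blockSymbol χ j) φ) := by
    have : lpBlock χ j (bilinearTerm u v) (𝓕 φ) = ofIntegrable (integrable_bilinearFourier u v)
      (𝓕⁻ (𝓕 (SchwartzMap.smulLeftCLM ℂ (blockSymbol χ j) (𝓕⁻ (𝓕 φ))))) := rfl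
    rw [this, FourierTransform.fourierInv_fourier_eq, FourierTransform.fourierInv_fourier_eq]
  rw [h1, ofIntegrable, Lp.toTemperedDistribution_apply]
  refine integral_congr_ae ?_
  filter_upwards [(memLp_one_iff_integrable.2 (integrable_bilinearFourier u v)).coeFn_toLp]
    with ξ hξ
  rw [hξ, SchwartzMap.smulLeftCLM_apply_apply (hasTemperateGrowth_blockSymbol hχ j), smul_eq_mul]

/-! ### Critical dyadic rescaling -/

section Rescale

variable {F : Type*} [NormedAddCommGroup F] [NormedSpace ℝ F]

/-- The critical dyadic rescaling `f ↦ 2^k f (2^k ·)`. -/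
def rescale (k : ℤ) : 𝓢(Plane, F) →L[ℝ] 𝓢(Plane, F) :=
  (2 : ℝ) ^ k • SchwartzMap.compCLMOfContinuousLinearEquiv ℝ
    (ContinuousLinearEquiv.smulLeft (Units.mk0 ((2 : ℝ) ^ k) (by positivity)) : Plane ≃L[ℝ] Plane)

theorem rescale_apply (k : ℤ) (f : 𝓢(Plane, F)) (x : Plane) :
    rescale k f x = (2 : ℝ) ^ k • f ((2 : ℝ) ^ k • x) := rfl

end Rescale

theorem complexify_rescale (k : ℤ) (u : 𝓢(Plane, Plane)) :
    complexify (rescale k u) = rescale k (complexify u) := by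
  ext1 x
  exact map_smul toC _ _

theorem integral_comp_zpow_smul {E : Type*} [NormedAddCommGroup E] [NormedSpace ℝ E]
    (f : Plane → E) (k : ℤ) :
    ∫ x, f ((2 : ℝ) ^ k • x) = ((2 : ℝ) ^ (-k)) ^ 2 • ∫ x, f x := by
  rw [Measure.integral_comp_smul, finrank_euclideanSpace, Fintype.card_fin,
    abs_of_pos (by positivity), zpow_neg, inv_pow]

/-- In two dimensions the factor $2^k$ and the Jacobian $2^{-2k}$ combine to $2^{-k}$, so the
Fourier transform exchanges the critical rescalings by $k$ and $-k$. -/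
theorem fourier_rescale {F : Type*} [NormedAddCommGroup F] [NormedSpace ℂ F] (k : ℤ)
    (f : 𝓢(Plane, F)) (ξ : Plane) :
    𝓕 (rescale k f) ξ = (2 : ℝ) ^ (-k) • 𝓕 f ((2 : ℝ) ^ (-k) • ξ) := by
  have h2 : (2 : ℝ) ^ k ≠ 0 := by positivity
  rw [SchwartzMap.fourier_coe, SchwartzMap.fourier_coe, Real.fourier_eq, Real.fourier_eq]
  have h := integral_comp_zpow_smul (fun x : Plane =>
    Real.fourierChar (-inner ℝ x ((2 : ℝ) ^ (-k) • ξ)) • (2 : ℝ) ^ k • f x) k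
  have hi : ∀ x : Plane, inner ℝ ((2 : ℝ) ^ k • x) ((2 : ℝ) ^ (-k) • ξ) = inner ℝ x ξ := by
    intro x
    rw [real_inner_smul_left, real_inner_smul_right, zpow_neg, mul_inv_cancel_left₀ h2]
  simp only [hi] at h
  simp only [rescale_apply]
  rw [h]
  simp only [smul_comm _ ((2 : ℝ) ^ k)]
  rw [integral_smul, smul_smul]
  congr 1
  rw [zpow_neg]
  field_simp

theorem eLpNorm_rescale {F : Type*} [NormedAddCommGroup F] [NormedSpace ℝ F] (k : ℤ)
    (f : 𝓢(Plane, F)) (p : ℝ≥0∞) : eLpNorm (rescale k f) p volume =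
      (2 : ℝ≥0∞) ^ ((k : ℝ) * (1 - 2 * (1 / p).toReal)) * eLpNorm f p volume := by
  have h : ⇑(rescale k f) = (2 : ℝ) ^ k • fun x => f ((2 : ℝ) ^ k • x) := rfl
  rw [h, eLpNorm_const_smul, eLpNorm_comp_zpow_smul, Real.enorm_of_nonneg (by positivity),
    ← Real.rpow_intCast, ← ENNReal.ofReal_rpow_of_pos (by norm_num), ENNReal.ofReal_ofNat,
    ← mul_assoc, ← ENNReal.rpow_add _ _ (by norm_num) (by norm_num)]
  congr 2
  ring

theorem blockSymbol_zpow_smul (χ : Plane → ℝ) (j k : ℤ) (ξ : Plane) :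
    blockSymbol χ (j - k) ((2 : ℝ) ^ (-k) • ξ) = blockSymbol χ j ξ := by
  simp only [blockSymbol]
  rw [smul_comm (2 * Real.pi) ((2 : ℝ) ^ (-k)), smul_smul, ← zpow_add₀ (by norm_num)]
  congr 4
  ring

theorem fourier_schwartzBlock {χ : Plane → ℝ} (hχ : IsLittlewoodPaley χ) (j : ℤ)
    (f : 𝓢(Plane, CVec)) (ξ : Plane) :
    𝓕 (schwartzBlock χ j f) ξ = blockSymbol χ j ξ • 𝓕 f ξ := by
  rw [schwartzBlock, SchwartzMap.fourierMultiplierCLM_apply,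
    FourierTransform.fourier_fourierInv_eq,
    SchwartzMap.smulLeftCLM_apply_apply (hasTemperateGrowth_blockSymbol hχ j)]

theorem schwartz_ext_fourier {f g : 𝓢(Plane, CVec)} (h : ∀ ξ, 𝓕 f ξ = 𝓕 g ξ) : f = g := by
  have h' : 𝓕 f = 𝓕 g := DFunLike.ext _ _ h
  have hf : 𝓕⁻ (𝓕 f) = f := FourierTransform.fourierInv_fourier_eq f
  have hg : 𝓕⁻ (𝓕 g) = g := FourierTransform.fourierInv_fourier_eq g
  rw [← hf, ← hg, h']

theorem schwartzBlock_rescale {χ : Plane → ℝ} (hχ : IsLittlewoodPaley χ) (j k : ℤ)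
    (f : 𝓢(Plane, CVec)) :
    schwartzBlock χ j (rescale k f) = rescale k (schwartzBlock χ (j - k) f) := by
  refine schwartz_ext_fourier fun ξ => ?_
  rw [fourier_schwartzBlock hχ, fourier_rescale, fourier_rescale, fourier_schwartzBlock hχ,
    blockSymbol_zpow_smul, smul_comm]

theorem schwartzBlock_eq_zero {χ : Plane → ℝ} (hχ : IsLittlewoodPaley χ) {j : ℤ}
    {f : 𝓢(Plane, CVec)} (h : ∀ ξ, blockSymbol χ j ξ • 𝓕 f ξ = 0) : schwartzBlock χ j f = 0 := by
  refine schwartz_ext_fourier fun ξ => ?_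
  rw [fourier_schwartzBlock hχ, h]
  exact (congrArg (· ξ) (map_zero (FourierTransform.fourierCLM ℂ 𝓢(Plane, CVec)))).symm

/-! ### Critical norms of superpositions of rescaled fields -/

/-- The weighted norms of the dyadic blocks of a Schwartz field. -/
def blockNorm (χ : Plane → ℝ) (p : ℝ≥0∞) (f : 𝓢(Plane, CVec)) (j : ℤ) : ℝ≥0∞ :=
  (2 : ℝ≥0∞) ^ (critReg p * (j : ℝ)) * eLpNorm (schwartzBlock χ j f) p volume

theorem critReg_eq (p : ℝ≥0∞) : critReg p = 2 * (1 / p).toReal - 1 := by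
  rw [critReg, ← mul_one_div, ENNReal.toReal_mul, ENNReal.toReal_ofNat]

theorem blockNorm_lt_top (χ : Plane → ℝ) (p : ℝ≥0∞) (f : 𝓢(Plane, CVec)) (j : ℤ) :
    blockNorm χ p f j < ∞ :=
  ENNReal.mul_lt_top (ENNReal.rpow_ne_top_of_ne_zero (by norm_num) (by norm_num)).lt_top
    ((schwartzBlock χ j f).memLp p volume).2

/-- Scaling invariance of the critical norm: the weight $2^{(2/p-1)j}$ exactly absorbs the change of
the $L^p$ norm, and only the dyadic index shifts. -/
theorem blockNorm_rescale {χ : Plane → ℝ} (hχ : IsLittlewoodPaley χ) (p : ℝ≥0∞) (j k : ℤ)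
    (f : 𝓢(Plane, CVec)) : blockNorm χ p (rescale k f) j = blockNorm χ p f (j - k) := by
  rw [blockNorm, schwartzBlock_rescale hχ, eLpNorm_rescale, blockNorm, ← mul_assoc,
    ← ENNReal.rpow_add _ _ (by norm_num) (by norm_num), critReg_eq]
  congr 2
  push_cast
  ring

/-- The superposition `a ∑_{k < n} 2^k w (2^k ·)`. -/
def superposition (w : 𝓢(Plane, Plane)) (a : ℝ) (n : ℕ) : 𝓢(Plane, Plane) :=
  a • ∑ k ∈ Finset.range n, rescale (k : ℤ) w

theorem complexify_superposition (w : 𝓢(Plane, Plane)) (a : ℝ) (n : ℕ) :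
    complexify (superposition w a n) =
      a • ∑ k ∈ Finset.range n, rescale (k : ℤ) (complexify w) := by
  simp only [← complexify_rescale]
  simp only [superposition, complexify, map_smul, map_sum]

theorem weighted_distLpNorm_superposition_le {χ : Plane → ℝ} (hχ : IsLittlewoodPaley χ)
    {p : ℝ≥0∞} (hp : 1 ≤ p) (w : 𝓢(Plane, Plane)) (a : ℝ) (n : ℕ) (j : ℤ) :
    (2 : ℝ≥0∞) ^ (critReg p * (j : ℝ)) *
        distLpNorm p (lpBlock χ j (toDist (superposition w a n))) ≤
      ‖a‖ₑ * ∑ k ∈ Finset.range n, blockNorm χ p (complexify w) (j - k) := by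
  have hs : ⇑(schwartzBlock χ j (complexify (superposition w a n))) =
      a • ∑ k ∈ Finset.range n, ⇑(schwartzBlock χ j (rescale (k : ℤ) (complexify w))) := by
    rw [complexify_superposition, ← Complex.coe_smul, map_smul, map_sum]
    ext1 x
    simp
  rw [lpBlock_toDist hχ]
  calc _ ≤ (2 : ℝ≥0∞) ^ (critReg p * (j : ℝ)) *
        (‖a‖ₑ * ∑ k ∈ Finset.range n,
          eLpNorm (schwartzBlock χ j (rescale (k : ℤ) (complexify w))) p volume) := by
        gcongr
        refine (distLpNorm_le p _).trans ?_
        rw [hs, eLpNorm_const_smul]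
        gcongr
        exact eLpNorm_sum_le (fun k _ => (SchwartzMap.memLp _ p volume).1) hp
    _ = ‖a‖ₑ * ∑ k ∈ Finset.range n, blockNorm χ p (rescale (k : ℤ) (complexify w)) j := by
        rw [mul_left_comm, Finset.mul_sum]
        rfl
    _ = _ := by simp only [blockNorm_rescale hχ]

theorem sum_sub_le_tsum (b : ℤ → ℝ≥0∞) (n : ℕ) (j : ℤ) :
    ∑ k ∈ Finset.range n, b (j - k) ≤ ∑' i, b i := by
  have hinj : Function.Injective (fun k : ℕ => j - (k : ℤ)) := fun k l h => by
    simpa using h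
  calc _ = ∑ i ∈ (Finset.range n).map ⟨_, hinj⟩, b i := by
        rw [Finset.sum_map]
        rfl
    _ ≤ _ := ENNReal.sum_le_tsum _

/-- The bound does not depend on `n`: in a fixed block the `n` rescaled copies contribute distinct
terms of a single sequence, so they add up to at most its $\ell^1$ sum. -/
theorem critNorm_top_superposition_le {χ : Plane → ℝ} (hχ : IsLittlewoodPaley χ)
    {p : ℝ≥0∞} (hp : 1 ≤ p) (w : 𝓢(Plane, Plane)) (a : ℝ) (n : ℕ) :
    critNorm χ p ∞ (toDist (superposition w a n)) ≤
      ‖a‖ₑ * ∑' i, blockNorm χ p (complexify w) i := by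
  rw [critNorm, besovNorm, ellNorm, if_pos rfl]
  refine iSup_le fun j => (weighted_distLpNorm_superposition_le hχ hp w a n j).trans ?_
  gcongr
  exact sum_sub_le_tsum _ n j

/-- With `n = 1` the superposition has only the term `k = 0`, so it is the multiple $aw$. -/
theorem critNorm_smul_le {χ : Plane → ℝ} (hχ : IsLittlewoodPaley χ) {p q : ℝ≥0∞} (hp : 1 ≤ p)
    (hq : 1 ≤ q) (hq' : q < ∞) (w : 𝓢(Plane, Plane)) (a : ℝ) :
    critNorm χ p q (toDist (superposition w a 1)) ≤
      ‖a‖ₑ * (∑' i, blockNorm χ p (complexify w) i ^ q.toReal) ^ (1 / q.toReal) := by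
  have hq0 : 0 < q.toReal := ENNReal.toReal_pos (by positivity) hq'.ne
  rw [critNorm, besovNorm, ellNorm, if_neg hq'.ne]
  calc _ ≤ (∑' i, (‖a‖ₑ * blockNorm χ p (complexify w) i) ^ q.toReal) ^ (1 / q.toReal) := by
        refine ENNReal.rpow_le_rpow (ENNReal.tsum_le_tsum fun i =>
          ENNReal.rpow_le_rpow ?_ hq0.le) (by positivity)
        simpa using weighted_distLpNorm_superposition_le hχ hp w a 1 i
    _ = _ := by
        simp only [ENNReal.mul_rpow_of_nonneg _ _ hq0.le]
        rw [ENNReal.tsum_mul_left, ENNReal.mul_rpow_of_nonneg _ _ (by positivity),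
          ← ENNReal.rpow_mul, mul_one_div_cancel hq0.ne', ENNReal.rpow_one]

/-- A field with Fourier transform supported in the annulus `1/2 ≤ |ξ| ≤ 2` has finitely many
nonzero dyadic blocks. -/
theorem blockNorm_eq_zero {χ : Plane → ℝ} (hχ : IsLittlewoodPaley χ) (p : ℝ≥0∞)
    {f : 𝓢(Plane, CVec)} (hf : ∀ ξ, 𝓕 f ξ ≠ 0 → 2⁻¹ ≤ ‖ξ‖ ∧ ‖ξ‖ ≤ 2) {j : ℤ}
    (hj : j ∉ Finset.Icc (0 : ℤ) 5) : blockNorm χ p f j = 0 := by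
  have h0 : schwartzBlock χ j f = 0 := by
    refine schwartzBlock_eq_zero hχ fun ξ => ?_
    by_contra h
    obtain ⟨h1, h2⟩ := smul_ne_zero_iff.1 h
    obtain ⟨h3, h4⟩ := hf ξ h2
    have hn : ‖(2 : ℝ) ^ (-j) • (2 * Real.pi) • ξ‖ = (2 : ℝ) ^ (-j) * (2 * Real.pi * ‖ξ‖) := by
      rw [norm_smul, norm_smul, Real.norm_of_nonneg (by positivity),
        Real.norm_of_nonneg (by positivity)]
    have hpi := Real.pi_gt_three
    have hpi' := Real.pi_lt_four
    rw [Finset.mem_Icc, not_and_or, not_le, not_le] at hj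
    refine h1 ?_
    rw [blockSymbol, Complex.ofReal_eq_zero]
    rcases hj with hj | hj
    -- For $j\le-1$ the argument of $\chi$ has norm at least $2\cdot2\pi\cdot\frac12>2$.
    · refine hχ.eq_zero_of_lt_norm ?_
      have : (2 : ℝ) ^ (1 : ℤ) ≤ (2 : ℝ) ^ (-j) := zpow_le_zpow_right₀ (by norm_num) (by omega)
      rw [hn]
      calc (2 : ℝ) < 2 ^ (1 : ℤ) * (2 * 3 * 2⁻¹) := by norm_num
        _ ≤ _ := by gcongr
    -- For $j\ge6$ it has norm at most $2^{-6}\cdot2\pi\cdot2<\frac12$.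
    · refine hχ.eq_zero_of_norm_lt ?_
      have : (2 : ℝ) ^ (-j) ≤ (2 : ℝ) ^ (-6 : ℤ) := zpow_le_zpow_right₀ (by norm_num) (by omega)
      rw [hn]
      calc _ ≤ (2 : ℝ) ^ (-6 : ℤ) * (2 * 4 * 2) := by gcongr
        _ < 2⁻¹ := by norm_num
  rw [blockNorm, h0]
  have : ⇑(0 : 𝓢(Plane, CVec)) = 0 := rfl
  rw [this, eLpNorm_zero, mul_zero]

theorem tsum_blockNorm_rpow_lt_top {χ : Plane → ℝ} (hχ : IsLittlewoodPaley χ) (p : ℝ≥0∞)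
    {f : 𝓢(Plane, CVec)} (hf : ∀ ξ, 𝓕 f ξ ≠ 0 → 2⁻¹ ≤ ‖ξ‖ ∧ ‖ξ‖ ≤ 2) {r : ℝ} (hr : 0 < r) :
    ∑' i, blockNorm χ p f i ^ r < ∞ := by
  rw [tsum_eq_sum (s := Finset.Icc (0 : ℤ) 5) fun i hi => by
    rw [blockNorm_eq_zero hχ p hf hi, ENNReal.zero_rpow_of_pos hr]]
  exact ENNReal.sum_lt_top.2 fun i _ =>
    ENNReal.rpow_lt_top_of_nonneg hr.le (blockNorm_lt_top χ p f i).ne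

/-! ### The bilinear term at low frequencies -/

/-- The symbol of `(-Δ)⁻¹ ℙ div` at the frequency `ξ`, applied to a matrix with rows `R k`. -/
def lowFrequencySymbol (ξ : Plane) (R : Fin 2 → CVec) : CVec :=
  invLaplaceHelmholtzSymbol ((2 * Real.pi) • ξ)
    (∑ k, (2 * Real.pi * Complex.I * (ξ k : ℂ)) • R k)

theorem fourier_complexify_divTensor (u v : 𝓢(Plane, Plane)) (ξ : Plane) :
    𝓕 (complexify (divTensor u v)) ξ =
      ∑ k, (2 * Real.pi * Complex.I * (ξ k : ℂ)) • 𝓕 (complexify (tensorRow u v k)) ξ := by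
  have h1 : 𝓕 (complexify (divTensor u v)) =
      ∑ k, 𝓕 (∂_{unitVec k} (complexify (tensorRow u v k))) := by
    rw [complexify_divTensor]
    exact map_sum (FourierTransform.fourierCLM ℂ 𝓢(Plane, CVec)) _ _
  rw [h1, sum_apply]
  refine Finset.sum_congr rfl fun k _ => ?_
  have hg : (fun ξ : Plane => inner ℝ ξ (unitVec k)).HasTemperateGrowth := by fun_prop
  rw [SchwartzMap.fourier_lineDerivOp_eq, smul_apply,
    SchwartzMap.smulLeftCLM_apply_apply hg, ← Complex.coe_smul, smul_smul]
  simp [EuclideanSpace.inner_single_right]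

theorem bilinearFourier_eq (u v : 𝓢(Plane, Plane)) (ξ : Plane) :
    bilinearFourier u v ξ = lowFrequencySymbol ξ fun k => 𝓕 (complexify (tensorRow u v k)) ξ := by
  rw [bilinearFourier, fourier_complexify_divTensor, lowFrequencySymbol]

theorem helmholtzSymbol_apply (η : Plane) (z : CVec) (j : Fin 2) :
    helmholtzSymbol η z j = ∑ k,
      (((if j = k then (1 : ℝ) else 0) - η j * η k / ‖η‖ ^ 2 : ℝ) : ℂ) * z k := rfl

theorem helmholtzSymbol_smul_left {c : ℝ} (hc : c ≠ 0) (η : Plane) (z : CVec) :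
    helmholtzSymbol (c • η) z = helmholtzSymbol η z := by
  ext j
  rw [helmholtzSymbol_apply, helmholtzSymbol_apply]
  refine Finset.sum_congr rfl fun k _ => ?_
  have h : (c • η) j * (c • η) k / ‖c • η‖ ^ 2 = η j * η k / ‖η‖ ^ 2 := by
    rw [norm_smul, mul_pow, Real.norm_eq_abs, sq_abs, PiLp.smul_apply, PiLp.smul_apply,
      smul_eq_mul, smul_eq_mul, mul_mul_mul_comm, ← sq, mul_div_mul_left _ _ (pow_ne_zero 2 hc)]
  rw [h]

theorem helmholtzSymbol_smul_right (c : ℂ) (η : Plane) (z : CVec) :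
    helmholtzSymbol η (c • z) = c • helmholtzSymbol η z := by
  ext j
  rw [PiLp.smul_apply, helmholtzSymbol_apply, helmholtzSymbol_apply, smul_eq_mul, Finset.mul_sum]
  refine Finset.sum_congr rfl fun k _ => ?_
  rw [PiLp.smul_apply, smul_eq_mul]
  ring

/-- Degree $-1$: the divergence contributes $1$, the inverse Laplacian $-2$ and the Helmholtz
projection $0$. -/
theorem lowFrequencySymbol_smul {c : ℝ} (hc : 0 < c) (ξ : Plane) (R : Fin 2 → CVec) :
    lowFrequencySymbol (c • ξ) R = c⁻¹ • lowFrequencySymbol ξ R := by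
  have h1 : ∑ k, (2 * Real.pi * Complex.I * ((c • ξ) k : ℂ)) • R k =
      (c : ℂ) • ∑ k, (2 * Real.pi * Complex.I * (ξ k : ℂ)) • R k := by
    rw [Finset.smul_sum]
    refine Finset.sum_congr rfl fun k _ => ?_
    rw [smul_smul, PiLp.smul_apply, smul_eq_mul, Complex.ofReal_mul]
    congr 1
    ring
  rw [lowFrequencySymbol, h1, lowFrequencySymbol, invLaplaceHelmholtzSymbol,
    invLaplaceHelmholtzSymbol, smul_comm (2 * Real.pi) c, helmholtzSymbol_smul_left hc.ne',
    helmholtzSymbol_smul_right, norm_smul c ((2 * Real.pi) • ξ), Real.norm_of_nonneg hc.le,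
    smul_smul, ← Complex.coe_smul, smul_smul]
  congr 1
  have : (c : ℂ) ≠ 0 := by exact_mod_cast hc.ne'
  push_cast
  field_simp

theorem norm_lowFrequencySymbol_le (ξ : Plane) (R : Fin 2 → CVec) :
    ‖lowFrequencySymbol ξ R‖ ≤ 8 * ‖ξ‖⁻¹ * ∑ k, ‖R k‖ := by
  rcases eq_or_ne ξ 0 with rfl | hξ
  · simp [lowFrequencySymbol, invLaplaceHelmholtzSymbol]
  have hpos : 0 < ‖ξ‖ := norm_pos_iff.2 hξ
  have hpi : 1 ≤ 2 * Real.pi := by linarith [Real.pi_gt_three]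
  have hs : ‖∑ k, (2 * Real.pi * Complex.I * (ξ k : ℂ)) • R k‖ ≤
      2 * Real.pi * ‖ξ‖ * ∑ k, ‖R k‖ := by
    rw [Finset.mul_sum]
    refine (norm_sum_le _ _).trans (Finset.sum_le_sum fun k _ => ?_)
    rw [norm_smul]
    gcongr
    have : |ξ k| ≤ ‖ξ‖ := by simpa using PiLp.norm_apply_le ξ k
    simp only [norm_mul, Complex.norm_I, Complex.norm_real, Real.norm_eq_abs,
      abs_of_pos Real.pi_pos, Complex.norm_ofNat, mul_one]
    gcongr
  have hR : 0 ≤ ∑ k, ‖R k‖ := Finset.sum_nonneg fun k _ => norm_nonneg _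
  have hP := norm_helmholtzSymbol_le ((2 * Real.pi) • ξ)
    (∑ k, (2 * Real.pi * Complex.I * (ξ k : ℂ)) • R k)
  rw [lowFrequencySymbol, invLaplaceHelmholtzSymbol, norm_smul, Complex.norm_real, norm_smul,
    Real.norm_of_nonneg (by positivity : (0 : ℝ) ≤ 2 * Real.pi), Real.norm_of_nonneg (by positivity)]
  calc _ ≤ ((2 * Real.pi * ‖ξ‖) ^ 2)⁻¹ * (8 * (2 * Real.pi * ‖ξ‖ * ∑ k, ‖R k‖)) := by
        refine mul_le_mul_of_nonneg_left ?_ (by positivity)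
        exact hP.trans (mul_le_mul_of_nonneg_left hs (by norm_num))
    _ = (2 * Real.pi)⁻¹ * (8 * ‖ξ‖⁻¹ * ∑ k, ‖R k‖) := by field_simp
    _ ≤ 1 * (8 * ‖ξ‖⁻¹ * ∑ k, ‖R k‖) := by
        refine mul_le_mul_of_nonneg_right (inv_le_one_of_one_le₀ hpi) ?_
        exact mul_nonneg (by positivity) hR
    _ = _ := one_mul _

theorem continuous_lowFrequencySymbol (ξ : Plane) : Continuous (lowFrequencySymbol ξ) := by
  have hR : ∀ k l : Fin 2, Continuous fun R : Fin 2 → CVec => R k l := fun k l =>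
    (EuclideanSpace.proj l : CVec →L[ℂ] ℂ).continuous.comp (continuous_apply k)
  have hcoord : ∀ j, Continuous fun R : Fin 2 → CVec => helmholtzSymbol ((2 * Real.pi) • ξ)
      (∑ k, (2 * Real.pi * Complex.I * (ξ k : ℂ)) • R k) j := ?_
  · have hH : Continuous fun R : Fin 2 → CVec => helmholtzSymbol ((2 * Real.pi) • ξ)
        (∑ k, (2 * Real.pi * Complex.I * (ξ k : ℂ)) • R k) :=
      (PiLp.continuous_toLp 2 fun _ : Fin 2 => ℂ).comp (continuous_pi hcoord)
    exact hH.const_smul (((‖(2 * Real.pi) • ξ‖ ^ 2)⁻¹ : ℝ) : ℂ)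
  intro j
  simp only [helmholtzSymbol_apply]
  refine continuous_finsetSum _ fun k _ => continuous_const.mul ?_
  have : (fun R : Fin 2 → CVec => (∑ l, (2 * Real.pi * Complex.I * (ξ l : ℂ)) • R l) k) =
      fun R => ∑ l, (2 * Real.pi * Complex.I * (ξ l : ℂ)) * R l k := by
    ext R
    simp
  rw [this]
  exact continuous_finsetSum _ fun l _ => continuous_const.mul (hR l k)

theorem measurable_lowFrequencySymbol {R : Plane → Fin 2 → CVec} (hR : ∀ k, Measurable (R · k)) :
    Measurable fun ξ => lowFrequencySymbol ξ (R ξ) := by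
  have hξ : ∀ k : Fin 2, Measurable fun ξ : Plane => ξ k := fun k =>
    (EuclideanSpace.proj k : Plane →L[ℝ] ℝ).continuous.measurable
  have hη : ∀ k : Fin 2, Measurable fun ξ : Plane => ((2 * Real.pi) • ξ) k := fun k =>
    (hξ k).const_mul _
  have hn : Measurable (fun ξ : Plane => ‖(2 * Real.pi) • ξ‖) :=
    (measurable_const_smul _).norm
  have hz : Measurable fun ξ : Plane =>
      ∑ k, (2 * Real.pi * Complex.I * (ξ k : ℂ)) • R ξ k :=
    Finset.measurable_sum _ fun k _ =>
      (measurable_const.mul (Complex.measurable_ofReal.comp (hξ k))).smul (hR k)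
  have hA : Measurable (fun ξ : Plane => (((‖(2 * Real.pi) • ξ‖ ^ 2)⁻¹ : ℝ) : ℂ)) :=
    Complex.measurable_ofReal.comp (hn.pow_const 2).inv
  refine hA.smul ((WithLp.measurable_toLp 2 (Fin 2 → ℂ)).comp (measurable_pi_lambda _ fun j => ?_))
  refine Finset.measurable_sum _ fun k _ => Measurable.mul ?_
    ((EuclideanSpace.proj k : CVec →L[ℂ] ℂ).continuous.measurable.comp hz)
  exact Complex.measurable_ofReal.comp
    (measurable_const.sub (((hη j).mul (hη k)).div (hn.pow_const 2)))

/-! ### A test function for the low frequencies -/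

theorem contDiff_dilated {χ : Plane → ℝ} (hχ : IsLittlewoodPaley χ) :
    ContDiff ℝ ((⊤ : ℕ∞) : WithTop ℕ∞) fun ξ : Plane => χ ((2 * Real.pi) • ξ) :=
  hχ.smooth.comp (contDiff_const_smul _)

theorem hasCompactSupport_dilated {χ : Plane → ℝ} (hχ : IsLittlewoodPaley χ) :
    HasCompactSupport fun ξ : Plane => χ ((2 * Real.pi) • ξ) :=
  hχ.hasCompactSupport.comp_smul (by positivity)

theorem contDiff_coord (k : Fin 2) :
    ContDiff ℝ ((⊤ : ℕ∞) : WithTop ℕ∞) fun ξ : Plane => ξ k :=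
  (EuclideanSpace.proj k : Plane →L[ℝ] ℝ).contDiff

/-- The function `ξ ↦ ξ₁ |ξ|⁴ χ(2πξ)`. -/
def realTestFunction (χ : Plane → ℝ) (ξ : Plane) : ℝ :=
  ξ 0 * (‖ξ‖ ^ 2) ^ 2 * χ ((2 * Real.pi) • ξ)

theorem contDiff_realTestFunction {χ : Plane → ℝ} (hχ : IsLittlewoodPaley χ) :
    ContDiff ℝ ((⊤ : ℕ∞) : WithTop ℕ∞) (realTestFunction χ) :=
  ((contDiff_coord 0).mul ((contDiff_norm_sq ℝ).pow 2)).mul (contDiff_dilated hχ)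

theorem hasCompactSupport_realTestFunction {χ : Plane → ℝ} (hχ : IsLittlewoodPaley χ) :
    HasCompactSupport (realTestFunction χ) :=
  (hasCompactSupport_dilated hχ).mul_left

/-- A smooth compactly supported real function as a complex Schwartz function. -/
def bumpToSchwartz {f : Plane → ℝ} (hf : HasCompactSupport f)
    (hf' : ContDiff ℝ ((⊤ : ℕ∞) : WithTop ℕ∞) f) : 𝓢(Plane, ℂ) :=
  (hf.toSchwartzMap hf').postcompCLM Complex.ofRealCLM

theorem bumpToSchwartz_apply {f : Plane → ℝ} (hf : HasCompactSupport f)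
    (hf' : ContDiff ℝ ((⊤ : ℕ∞) : WithTop ℕ∞) f) (ξ : Plane) :
    bumpToSchwartz hf hf' ξ = (f ξ : ℂ) := rfl

/-- The test function as a Schwartz function. -/
def testFunction {χ : Plane → ℝ} (hχ : IsLittlewoodPaley χ) : 𝓢(Plane, ℂ) :=
  bumpToSchwartz (hasCompactSupport_realTestFunction hχ) (contDiff_realTestFunction hχ)

theorem testFunction_apply {χ : Plane → ℝ} (hχ : IsLittlewoodPaley χ) (ξ : Plane) :
    testFunction hχ ξ = ((ξ 0 * (‖ξ‖ ^ 2) ^ 2 * χ ((2 * Real.pi) • ξ) : ℝ) : ℂ) := rfl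

/-- The pairing of the bilinear term, dilated to unit frequency, with the test function. -/
def lowFrequencyPairing {χ : Plane → ℝ} (hχ : IsLittlewoodPaley χ) (u v : 𝓢(Plane, Plane))
    (c : ℝ) : CVec :=
  ∫ ξ, (blockSymbol χ 0 ξ * testFunction hχ ξ) •
    lowFrequencySymbol ξ fun k => 𝓕 (complexify (tensorRow u v k)) (c • ξ)

/-- After the substitution $\xi\mapsto2^j\xi$ the Jacobian $2^{2j}$ cancels a factor $2^{-j}$ from
the rescaled test function and another from the homogeneity of the symbol. The scale survives only
in the argument of the transforms of the products. -/
theorem lpBlock_bilinearTerm_testFunction {χ : Plane → ℝ} (hχ : IsLittlewoodPaley χ)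
    (u v : 𝓢(Plane, Plane)) (j : ℤ) :
    lpBlock χ j (bilinearTerm u v) (𝓕 (rescale (-j) (testFunction hχ))) =
      lowFrequencyPairing hχ u v ((2 : ℝ) ^ j) := by
  have h2 : (0 : ℝ) < 2 ^ j := by positivity
  rw [lpBlock_bilinearTerm_fourier hχ, lowFrequencyPairing]
  have h := integral_comp_zpow_smul (fun ξ : Plane =>
    (blockSymbol χ j ξ * rescale (-j) (testFunction hχ) ξ) • bilinearFourier u v ξ) j
  have hc : ((2 : ℝ) ^ (-j)) ^ 2 ≠ 0 := by positivity
  rw [eq_comm, ← eq_inv_smul_iff₀ hc] at h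
  rw [h, ← integral_smul]
  refine integral_congr_ae (Eventually.of_forall fun ξ => ?_)
  have hb : blockSymbol χ j ((2 : ℝ) ^ j • ξ) = blockSymbol χ 0 ξ := by
    rw [← blockSymbol_zpow_smul χ j j, smul_smul, ← zpow_add₀ (by norm_num)]
    simp
  have hr : rescale (-j) (testFunction hχ) ((2 : ℝ) ^ j • ξ) =
      (((2 : ℝ) ^ j)⁻¹ : ℝ) • testFunction hχ ξ := by
    rw [rescale_apply, smul_smul, ← zpow_add₀ (by norm_num)]
    simp
  simp only
  rw [hb, hr, bilinearFourier_eq, lowFrequencySymbol_smul h2, zpow_neg]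
  rw [mul_smul_comm, smul_assoc, smul_comm _ ((2 : ℝ) ^ j)⁻¹ (lowFrequencySymbol _ _), smul_smul,
    smul_smul]
  have : ((((2 : ℝ) ^ j)⁻¹) ^ 2)⁻¹ * ((2 : ℝ) ^ j)⁻¹ * ((2 : ℝ) ^ j)⁻¹ = 1 := by
    field_simp
  rw [this, one_smul]

/-- The factor $\xi_1$ of the test function compensates the singularity $|\xi|^{-1}$ of the symbol.
The majorant is independent of the dilation, as dominated convergence requires. -/
theorem norm_lowFrequencyPairing_integrand_le {χ : Plane → ℝ} (hχ : IsLittlewoodPaley χ)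
    {B : ℝ} {ξ : Plane} {R : Fin 2 → CVec} (hB : ∑ k, ‖R k‖ ≤ B) :
    ‖(blockSymbol χ 0 ξ * testFunction hχ ξ) • lowFrequencySymbol ξ R‖ ≤
      ‖ξ‖ ^ 4 * χ ((2 * Real.pi) • ξ) * (8 * B) := by
  have h1 : ‖blockSymbol χ 0 ξ‖ ≤ 1 := by
    rw [blockSymbol, Complex.norm_real, Real.norm_of_nonneg (hχ.nonneg _)]
    exact hχ.le_one _
  have hξ : |ξ 0| ≤ ‖ξ‖ := by simpa using PiLp.norm_apply_le ξ 0
  have h2 : ‖testFunction hχ ξ‖ ≤ ‖ξ‖ * ‖ξ‖ ^ 4 * χ ((2 * Real.pi) • ξ) := by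
    rw [testFunction_apply, Complex.norm_real, norm_mul, norm_mul, Real.norm_eq_abs (ξ 0),
      Real.norm_of_nonneg (hχ.nonneg _), Real.norm_of_nonneg (by positivity), ← pow_mul]
    have := hχ.nonneg ((2 * Real.pi) • ξ)
    gcongr
  have hχ0 := hχ.nonneg ((2 * Real.pi) • ξ)
  have hB0 : 0 ≤ B := (Finset.sum_nonneg fun k _ => norm_nonneg _).trans hB
  rw [norm_smul, norm_mul]
  calc _ ≤ 1 * (‖ξ‖ * ‖ξ‖ ^ 4 * χ ((2 * Real.pi) • ξ)) * (8 * ‖ξ‖⁻¹ * B) := by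
        gcongr
        exact (norm_lowFrequencySymbol_le _ _).trans (by gcongr)
    _ = (‖ξ‖ * ‖ξ‖⁻¹) * (‖ξ‖ ^ 4 * χ ((2 * Real.pi) • ξ) * (8 * B)) := by ring
    _ ≤ 1 * (‖ξ‖ ^ 4 * χ ((2 * Real.pi) • ξ) * (8 * B)) := by
        gcongr
        exact mul_inv_le_one
    _ = _ := one_mul _

theorem measurable_lowFrequencyPairing_integrand {χ : Plane → ℝ} (hχ : IsLittlewoodPaley χ)
    (u v : 𝓢(Plane, Plane)) (c : ℝ) :
    AEStronglyMeasurable (fun ξ : Plane => (blockSymbol χ 0 ξ * testFunction hχ ξ) •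
      lowFrequencySymbol ξ fun k => 𝓕 (complexify (tensorRow u v k)) (c • ξ)) volume := by
  have hcont : ∀ k, Continuous (𝓕 (complexify (tensorRow u v k)) : 𝓢(Plane, CVec)) := fun k =>
    SchwartzMap.continuous _
  have h1 : Measurable (blockSymbol χ 0) :=
    Complex.measurable_ofReal.comp (hχ.smooth.continuous.measurable.comp
      ((measurable_const_smul ((2 : ℝ) ^ (-0 : ℤ))).comp (measurable_const_smul (2 * Real.pi))))
  have h2 : Measurable (testFunction hχ) := (SchwartzMap.continuous _).measurable
  exact ((h1.mul h2).smul (measurable_lowFrequencySymbol fun k =>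
    (hcont k).measurable.comp (measurable_const_smul c))).aestronglyMeasurable

theorem exists_sum_norm_fourier_tensorRow_le (u v : 𝓢(Plane, Plane)) :
    ∃ B, ∀ ξ, ∑ k, ‖𝓕 (complexify (tensorRow u v k)) ξ‖ ≤ B :=
  ⟨∑ k, SchwartzMap.seminorm ℝ 0 0 (𝓕 (complexify (tensorRow u v k)) : 𝓢(Plane, CVec)), fun ξ =>
    Finset.sum_le_sum fun _ _ => SchwartzMap.norm_le_seminorm ℝ _ ξ⟩

theorem integrable_lowFrequencyPairing_bound {χ : Plane → ℝ} (hχ : IsLittlewoodPaley χ) (B : ℝ) :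
    Integrable (fun ξ : Plane => ‖ξ‖ ^ 4 * χ ((2 * Real.pi) • ξ) * (8 * B)) volume := by
  refine Integrable.mul_const (Continuous.integrable_of_hasCompactSupport ?_ ?_) _
  · exact (continuous_norm.pow 4).mul (contDiff_dilated hχ).continuous
  · exact (hasCompactSupport_dilated hχ).mul_left

theorem integrable_lowFrequencyPairing {χ : Plane → ℝ} (hχ : IsLittlewoodPaley χ)
    (u v : 𝓢(Plane, Plane)) (c : ℝ) :
    Integrable (fun ξ : Plane => (blockSymbol χ 0 ξ * testFunction hχ ξ) •
      lowFrequencySymbol ξ fun k => 𝓕 (complexify (tensorRow u v k)) (c • ξ)) volume := by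
  obtain ⟨B, hB⟩ := exists_sum_norm_fourier_tensorRow_le u v
  exact (integrable_lowFrequencyPairing_bound hχ B).mono'
    (measurable_lowFrequencyPairing_integrand hχ u v c)
    (Eventually.of_forall fun ξ => norm_lowFrequencyPairing_integrand_le hχ (hB _))

theorem tendsto_lowFrequencyPairing {χ : Plane → ℝ} (hχ : IsLittlewoodPaley χ)
    (u v : 𝓢(Plane, Plane)) {c : ℕ → ℝ} (hc : Tendsto c atTop (𝓝 0)) :
    Tendsto (fun n => lowFrequencyPairing hχ u v (c n)) atTop
      (𝓝 (lowFrequencyPairing hχ u v 0)) := by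
  obtain ⟨B, hB⟩ := exists_sum_norm_fourier_tensorRow_le u v
  have hcont : ∀ k, Continuous (𝓕 (complexify (tensorRow u v k)) : 𝓢(Plane, CVec)) := fun k =>
    SchwartzMap.continuous _
  refine tendsto_integral_filter_of_dominated_convergence _
    (Eventually.of_forall fun n => measurable_lowFrequencyPairing_integrand hχ u v (c n))
    (Eventually.of_forall fun n => Eventually.of_forall fun ξ =>
      norm_lowFrequencyPairing_integrand_le hχ (hB _))
    (integrable_lowFrequencyPairing_bound hχ B) ?_
  refine Eventually.of_forall fun ξ => Tendsto.const_smul ?_ _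
  refine ((continuous_lowFrequencySymbol ξ).tendsto _).comp (tendsto_pi_nhds.2 fun k => ?_)
  refine ((hcont k).tendsto _).comp ?_
  exact hc.smul_const ξ


/-! ### The zero-frequency limit and second moments -/

/-- The second moments of a field. -/
def secondMoment (u : 𝓢(Plane, Plane)) (k l : Fin 2) : ℝ := ∫ x, u x k * u x l

theorem fourier_tensorRow_zero (u : 𝓢(Plane, Plane)) (k l : Fin 2) :
    𝓕 (complexify (tensorRow u u k)) 0 l = secondMoment u k l := by
  have h1 : 𝓕 (complexify (tensorRow u u k)) 0 = ∫ x, complexify (tensorRow u u k) x := by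
    rw [SchwartzMap.fourier_coe, Real.fourier_eq]
    simp
  have h2 := (EuclideanSpace.proj l : CVec →L[ℂ] ℂ).integral_comp_comm
    (complexify (tensorRow u u k)).integrable (μ := volume)
  rw [h1, secondMoment, ← integral_complex_ofReal]
  exact h2.symm

/-- The weight of the traceless part of the second moments in the low frequencies. -/
def lowFrequencyWeight (χ : Plane → ℝ) : ℝ :=
  ∫ ξ : Plane, (χ ((2 * Real.pi) • ξ) * ξ 0 * ξ 1) ^ 2

/-- A scalar matrix has a gradient as its divergence, which the Helmholtz projection kills; hence
only the difference of the diagonal entries remains. -/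
theorem lowFrequencySymbol_diag_apply {ξ : Plane} (hξ : ξ ≠ 0) {R : Fin 2 → CVec}
    (h01 : R 0 1 = 0) (h10 : R 1 0 = 0) :
    lowFrequencySymbol ξ R 0 = Complex.I / (2 * Real.pi) *
      ((ξ 0 * ξ 1 ^ 2 / (‖ξ‖ ^ 2) ^ 2 : ℝ) : ℂ) * (R 0 0 - R 1 1) := by
  have hn : ‖ξ‖ ^ 2 = ξ 0 ^ 2 + ξ 1 ^ 2 := by
    rw [EuclideanSpace.norm_sq_eq, Fin.sum_univ_two]
    simp
  have hn0 : ξ 0 ^ 2 + ξ 1 ^ 2 ≠ 0 := by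
    rw [← hn]
    exact pow_ne_zero 2 (norm_ne_zero_iff.2 hξ)
  have hn0' : (ξ 0 : ℂ) ^ 2 + (ξ 1 : ℂ) ^ 2 ≠ 0 := by
    rw [← Complex.ofReal_pow, ← Complex.ofReal_pow, ← Complex.ofReal_add]
    exact Complex.ofReal_ne_zero.2 hn0
  have hpi : (Real.pi : ℂ) ≠ 0 := by exact_mod_cast Real.pi_ne_zero
  have hd : ‖(2 * Real.pi) • ξ‖ ^ 2 = (2 * Real.pi) ^ 2 * (ξ 0 ^ 2 + ξ 1 ^ 2) := by
    rw [norm_smul, mul_pow, hn, Real.norm_eq_abs, sq_abs]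
  rw [lowFrequencySymbol, invLaplaceHelmholtzSymbol, PiLp.smul_apply, smul_eq_mul,
    helmholtzSymbol_apply, hd, hn]
  simp only [Fin.sum_univ_two, PiLp.add_apply, PiLp.smul_apply, smul_eq_mul, h01, h10]
  simp only [if_true, if_false, zero_ne_one]
  push_cast
  field_simp
  ring

/-- Here the choice $\xi_1|\xi|^4\chi(2\pi\xi)$ pays off: times the block symbol and
$\xi_1\xi_2^2/|\xi|^4$ it gives the square $(\chi(2\pi\xi)\xi_1\xi_2)^2$, so no cancellation can
occur in the integral. -/
theorem lowFrequencyPairing_zero_apply {χ : Plane → ℝ} (hχ : IsLittlewoodPaley χ)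
    {u : 𝓢(Plane, Plane)} (hu : secondMoment u 0 1 = 0) :
    lowFrequencyPairing hχ u u 0 0 = Complex.I / (2 * Real.pi) *
      ((secondMoment u 0 0 - secondMoment u 1 1) * lowFrequencyWeight χ : ℝ) := by
  have hu' : secondMoment u 1 0 = 0 := by
    rw [← hu, secondMoment, secondMoment]
    simp only [mul_comm]
  have hI : ∀ ξ : Plane, ((blockSymbol χ 0 ξ * testFunction hχ ξ) •
      lowFrequencySymbol ξ fun k => 𝓕 (complexify (tensorRow u u k)) ((0 : ℝ) • ξ)) 0 =
      Complex.I / (2 * Real.pi) * ((secondMoment u 0 0 - secondMoment u 1 1 : ℝ) : ℂ) *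
        (((χ ((2 * Real.pi) • ξ) * ξ 0 * ξ 1) ^ 2 : ℝ) : ℂ) := by
    intro ξ
    rcases eq_or_ne ξ 0 with rfl | hξ
    · simp [testFunction_apply]
    have hn0 : (‖ξ‖ : ℂ) ≠ 0 := by exact_mod_cast norm_ne_zero_iff.2 hξ
    rw [PiLp.smul_apply, zero_smul, lowFrequencySymbol_diag_apply hξ, testFunction_apply,
      blockSymbol, smul_eq_mul, fourier_tensorRow_zero, fourier_tensorRow_zero]
    · simp only [neg_zero, zpow_zero, one_smul]
      push_cast
      field_simp
    · rw [fourier_tensorRow_zero, hu, Complex.ofReal_zero]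
    · rw [fourier_tensorRow_zero, hu', Complex.ofReal_zero]
  have hint : Integrable (fun ξ : Plane => (blockSymbol χ 0 ξ * testFunction hχ ξ) •
      lowFrequencySymbol ξ fun k => 𝓕 (complexify (tensorRow u u k)) ((0 : ℝ) • ξ)) :=
    integrable_lowFrequencyPairing hχ u u 0
  have h := (EuclideanSpace.proj 0 : CVec →L[ℂ] ℂ).integral_comp_comm hint
  refine h.symm.trans ((integral_congr_ae (Eventually.of_forall hI)).trans ?_)
  rw [integral_const_mul, integral_complex_ofReal, lowFrequencyWeight, Complex.ofReal_mul, mul_assoc]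

theorem lowFrequencyWeight_pos {χ : Plane → ℝ} (hχ : IsLittlewoodPaley χ) :
    0 < lowFrequencyWeight χ := by
  have hc : Continuous fun ξ : Plane => χ ((2 * Real.pi) • ξ) := (contDiff_dilated hχ).continuous
  obtain ⟨ξ, hξ⟩ : ∃ ξ : Plane, (χ ((2 * Real.pi) • ξ) * ξ 0 * ξ 1) ≠ 0 := by
    -- Some term of the partition of unity is nonzero at $(1,1)$, a direction in which neither
    -- coordinate vanishes.
    have h1 : (!₂[1, 1] : Plane) ≠ 0 := fun h => by
      simpa using congrArg (fun x : Plane => x 0) h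
    obtain ⟨j, hj⟩ : ∃ j : ℤ, χ ((2 : ℝ) ^ (-j) • !₂[1, 1]) ≠ 0 := by
      by_contra! h
      have := hχ.hasSum_one _ h1
      simp only [h] at this
      exact zero_ne_one (hasSum_zero.unique this)
    refine ⟨(2 * Real.pi)⁻¹ • (2 : ℝ) ^ (-j) • !₂[1, 1], ?_⟩
    rw [smul_inv_smul₀ (by positivity)]
    refine mul_ne_zero (mul_ne_zero hj ?_) ?_ <;> simp [Real.pi_ne_zero, zpow_ne_zero]
  refine Continuous.integral_pos_of_hasCompactSupport_nonneg_nonzero (x := ξ) ?_ ?_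
    (fun ξ => sq_nonneg _) (pow_ne_zero 2 hξ)
  · exact ((hc.mul (contDiff_coord 0).continuous).mul (contDiff_coord 1).continuous).pow 2
  · exact ((hasCompactSupport_dilated hχ).mul_right.mul_right).comp_left (g := fun x : ℝ => x ^ 2) (by simp)

/-! ### Lower bounds for dyadic blocks by duality -/

/-- Since $1-2/p'=2/p-1$, the dual norm of the rescaled test function grows exactly like the
critical weight. -/
theorem eLpNorm_fourier_rescale_neg {p p' : ℝ≥0∞} [h : p'.HolderConjugate p]
    (φ : 𝓢(Plane, ℂ)) (j : ℤ) :
    eLpNorm (𝓕 (rescale (-j) φ) : 𝓢(Plane, ℂ)) p' volume =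
      (2 : ℝ≥0∞) ^ (critReg p * (j : ℝ)) * eLpNorm (𝓕 φ : 𝓢(Plane, ℂ)) p' volume := by
  have h1 : 𝓕 (rescale (-j) φ) = rescale j (𝓕 φ) := by
    ext1 ξ
    rw [fourier_rescale, rescale_apply, neg_neg]
  have h2 : (1 / p').toReal = 1 - (1 / p).toReal := by
    have hs := h.inv_add_inv_eq_inv
    rw [inv_one] at hs
    have hp1 : p'⁻¹ ≠ ∞ := ne_top_of_le_ne_top ENNReal.one_ne_top (hs ▸ le_self_add)
    have hp2 : p⁻¹ ≠ ∞ := ne_top_of_le_ne_top ENNReal.one_ne_top (hs ▸ le_add_self)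
    rw [one_div, one_div, eq_sub_iff_add_eq, ← ENNReal.toReal_add hp1 hp2, hs, ENNReal.toReal_one]
  rw [h1, eLpNorm_rescale, h2, critReg_eq]
  congr 2
  ring

theorem enorm_lowFrequencyPairing_div_le {χ : Plane → ℝ} (hχ : IsLittlewoodPaley χ)
    {p p' : ℝ≥0∞} [p'.HolderConjugate p] (u v : 𝓢(Plane, Plane)) (j : ℤ) :
    ‖lowFrequencyPairing hχ u v ((2 : ℝ) ^ j)‖ₑ / eLpNorm (𝓕 (testFunction hχ) : 𝓢(Plane, ℂ)) p' volume ≤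
      (2 : ℝ≥0∞) ^ (critReg p * (j : ℝ)) * distLpNorm p (lpBlock χ j (bilinearTerm u v)) := by
  have h1 := enorm_apply_div_le_distLpNorm (p := p) (p' := p') (lpBlock χ j (bilinearTerm u v))
    (𝓕 (rescale (-j) (testFunction hχ)))
  rw [lpBlock_bilinearTerm_testFunction, eLpNorm_fourier_rescale_neg (p := p)] at h1
  have hc0 : (2 : ℝ≥0∞) ^ (critReg p * (j : ℝ)) ≠ 0 :=
    (ENNReal.rpow_pos (by norm_num) (by norm_num)).ne'
  have hc1 : (2 : ℝ≥0∞) ^ (critReg p * (j : ℝ)) ≠ ∞ :=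
    ENNReal.rpow_ne_top_of_ne_zero (by norm_num) (by norm_num)
  rw [← ENNReal.mul_div_mul_left _ _ hc0 hc1, mul_div_assoc]
  gcongr

/-- The dyadic blocks of `(-Δ)⁻¹ ℙ div (u ⊗ u)` at low frequencies are bounded below by the
difference of the second moments of `u`. -/
theorem exists_lowFrequency_lower_bound {χ : Plane → ℝ} (hχ : IsLittlewoodPaley χ)
    {p : ℝ≥0∞} (hp : 1 ≤ p) :
    ∃ κ : ℝ≥0∞, κ ≠ 0 ∧ ∀ u : 𝓢(Plane, Plane), secondMoment u 0 1 = 0 →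
      secondMoment u 0 0 ≠ secondMoment u 1 1 → ∀ᶠ n : ℕ in atTop,
        κ * ‖secondMoment u 0 0 - secondMoment u 1 1‖ₑ ≤
          (2 : ℝ≥0∞) ^ (critReg p * ((-(n : ℤ) : ℤ) : ℝ)) *
            distLpNorm p (lpBlock χ (-(n : ℤ)) (bilinearTerm u u)) := by
  have hW := lowFrequencyWeight_pos hχ
  have hpi := Real.pi_pos
  have := ENNReal.HolderConjugate.conjExponent hp
  have hconj : p.conjExponent.HolderConjugate p := this.symm
  -- The first component of the limiting pairing has modulus $W|M_{11}-M_{22}|/(2\pi)$, where $W$ is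
  -- the weight; half of it is kept, so that the inequality is strict in the limit and holds for all
  -- large `n`.
  refine ⟨ENNReal.ofReal (lowFrequencyWeight χ / (4 * Real.pi)) /
    eLpNorm (𝓕 (testFunction hχ) : 𝓢(Plane, ℂ)) p.conjExponent volume, ?_, fun u h01 hne => ?_⟩
  · refine ENNReal.div_ne_zero.2 ⟨?_, (SchwartzMap.memLp _ _ _).2.ne⟩
    rw [ENNReal.ofReal_ne_zero_iff]
    positivity
  have hD : 0 < |secondMoment u 0 0 - secondMoment u 1 1| := abs_pos.2 (sub_ne_zero.2 hne)
  have hlim : Tendsto (fun n : ℕ => ‖lowFrequencyPairing hχ u u ((2 : ℝ) ^ (-(n : ℤ)))‖) atTop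
      (𝓝 ‖lowFrequencyPairing hχ u u 0‖) := by
    refine (tendsto_lowFrequencyPairing hχ u u ?_).norm
    have h := tendsto_pow_atTop_nhds_zero_of_lt_one (r := (2 : ℝ)⁻¹) (by norm_num) (by norm_num)
    refine h.congr fun n => ?_
    rw [zpow_neg, zpow_natCast, inv_pow]
  have hlt : lowFrequencyWeight χ / (4 * Real.pi) * |secondMoment u 0 0 - secondMoment u 1 1| <
      ‖lowFrequencyPairing hχ u u 0‖ := by
    refine lt_of_lt_of_le ?_ (PiLp.norm_apply_le (lowFrequencyPairing hχ u u 0) 0)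
    rw [lowFrequencyPairing_zero_apply hχ h01, norm_mul, Complex.norm_real, norm_mul, norm_div,
      norm_mul, Complex.norm_I, Complex.norm_real, Complex.norm_ofNat, Real.norm_eq_abs,
      Real.norm_eq_abs, Real.norm_eq_abs, abs_of_pos hpi, abs_of_pos hW]
    have : lowFrequencyWeight χ / (4 * Real.pi) * |secondMoment u 0 0 - secondMoment u 1 1| =
        1 / 2 * (1 / (2 * Real.pi) *
          (|secondMoment u 0 0 - secondMoment u 1 1| * lowFrequencyWeight χ)) := by
      field_simp
      norm_num
    rw [this]
    have : 0 < 1 / (2 * Real.pi) *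
        (|secondMoment u 0 0 - secondMoment u 1 1| * lowFrequencyWeight χ) := by positivity
    linarith
  filter_upwards [hlim.eventually (lt_mem_nhds hlt)] with n hn
  refine le_trans ?_ (enorm_lowFrequencyPairing_div_le hχ u u _ (p' := p.conjExponent))
  rw [ENNReal.div_eq_inv_mul, mul_assoc, ENNReal.div_eq_inv_mul]
  gcongr
  rw [Real.enorm_eq_ofReal_abs, ← ENNReal.ofReal_mul (by positivity), ← ofReal_norm]
  exact ENNReal.ofReal_le_ofReal hn.le

theorem le_critNorm_top {χ : Plane → ℝ} {p : ℝ≥0∞} {T : 𝓢'(Plane, CVec)} {c : ℝ≥0∞}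
    (h : ∀ᶠ n : ℕ in atTop, c ≤ (2 : ℝ≥0∞) ^ (critReg p * ((-(n : ℤ) : ℤ) : ℝ)) *
      distLpNorm p (lpBlock χ (-(n : ℤ)) T)) : c ≤ critNorm χ p ∞ T := by
  obtain ⟨n, hn⟩ := h.exists
  rw [critNorm, besovNorm, ellNorm, if_pos rfl]
  exact hn.trans (le_iSup (fun j : ℤ => (2 : ℝ≥0∞) ^ (critReg p * (j : ℝ)) *
      distLpNorm p (lpBlock χ j T)) _)

theorem critNorm_eq_top {χ : Plane → ℝ} {p q : ℝ≥0∞} (hq : 1 ≤ q) (hq' : q < ∞)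
    {T : 𝓢'(Plane, CVec)} {c : ℝ≥0∞} (hc : c ≠ 0)
    (h : ∀ᶠ n : ℕ in atTop, c ≤ (2 : ℝ≥0∞) ^ (critReg p * ((-(n : ℤ) : ℤ) : ℝ)) *
      distLpNorm p (lpBlock χ (-(n : ℤ)) T)) : critNorm χ p q T = ∞ := by
  have hq0 : 0 < q.toReal := ENNReal.toReal_pos (by positivity) hq'.ne
  obtain ⟨m, hm⟩ := eventually_atTop.1 h
  rw [critNorm, besovNorm, ellNorm, if_neg hq'.ne]
  have hinj : Function.Injective fun n : ℕ => -((n + m : ℕ) : ℤ) := fun k l h => by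
    simpa using h
  have htop : ∑' _ : ℕ, c ^ q.toReal = ∞ :=
    ENNReal.tsum_const_eq_top_of_ne_zero (by simp [hc, hq0, hq0.le])
  have hle := ENNReal.tsum_comp_le_tsum_of_injective hinj fun j : ℤ =>
    ((2 : ℝ≥0∞) ^ (critReg p * (j : ℝ)) * distLpNorm p (lpBlock χ j T)) ^ q.toReal
  have hsum : ∑' j : ℤ, ((2 : ℝ≥0∞) ^ (critReg p * (j : ℝ)) *
      distLpNorm p (lpBlock χ j T)) ^ q.toReal = ∞ := by
    refine top_le_iff.1 (htop ▸ le_trans (ENNReal.tsum_le_tsum fun n => ?_) hle)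
    exact ENNReal.rpow_le_rpow (hm (n + m) (Nat.le_add_left _ _)) hq0.le
  rw [hsum, ENNReal.top_rpow_of_pos (by positivity)]

/-! ### Components and second moments -/

theorem fourier_apply_coord (f : 𝓢(Plane, CVec)) (j : Fin 2) (ξ : Plane) :
    𝓕 f ξ j = 𝓕 (f.postcompCLM (EuclideanSpace.proj j : CVec →L[ℂ] ℂ)) ξ := by
  rw [SchwartzMap.fourier_coe, SchwartzMap.fourier_coe, Real.fourier_eq, Real.fourier_eq]
  have hi : Integrable (fun x : Plane => Real.fourierChar (-inner ℝ x ξ) • f x) volume :=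
    (Real.fourierIntegral_convergent_iff ξ).2 f.integrable
  exact ((EuclideanSpace.proj j : CVec →L[ℂ] ℂ).integral_comp_comm hi).symm

/-- Parseval's identity; it gives both the orthogonality of rescaled copies and the moments of the
profile. -/
theorem integral_mul_eq_integral_fourier (u v : 𝓢(Plane, Plane)) (i j : Fin 2) :
    ((∫ x, u x i * v x j : ℝ) : ℂ) =
      ∫ ξ, inner ℂ (𝓕 (complexify u) ξ i) (𝓕 (complexify v) ξ j) := by
  have h := SchwartzMap.integral_inner_fourier_fourier
    ((complexify u).postcompCLM (EuclideanSpace.proj i : CVec →L[ℂ] ℂ))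
    ((complexify v).postcompCLM (EuclideanSpace.proj j : CVec →L[ℂ] ℂ))
  simp only [← fourier_apply_coord] at h
  rw [h, ← integral_complex_ofReal]
  refine integral_congr_ae (Eventually.of_forall fun x => ?_)
  have h1 : ∀ (w : 𝓢(Plane, Plane)) (l : Fin 2), (complexify w).postcompCLM
      (EuclideanSpace.proj l : CVec →L[ℂ] ℂ) x = (w x l : ℂ) := fun w l => rfl
  simp only [h1, RCLike.inner_apply, Complex.conj_ofReal]
  push_cast
  ring

theorem integrable_mul_coord (u v : 𝓢(Plane, Plane)) (i j : Fin 2) :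
    Integrable (fun x => u x i * v x j) volume :=
  (EuclideanSpace.proj j : Plane →L[ℝ] ℝ).integrable_comp (tensorRow u v i).integrable

/-- In the plane the critical rescaling preserves $L^2$ inner products. -/
theorem secondMoment_rescale (w : 𝓢(Plane, Plane)) (k : ℤ) (i j : Fin 2) :
    secondMoment (rescale k w) i j = secondMoment w i j := by
  have h := integral_comp_zpow_smul (fun x => (2 : ℝ) ^ k * w x i * ((2 : ℝ) ^ k * w x j)) k
  refine Eq.trans h ?_
  rw [secondMoment, ← integral_smul]
  refine integral_congr_ae (Eventually.of_forall fun x => ?_)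
  have h2 : (2 : ℝ) ^ k ≠ 0 := by positivity
  simp only [smul_eq_mul, zpow_neg]
  field_simp

/-- The Fourier transform of the field is supported in a pair of small boxes. -/
def IsSpectrallyLocalized (w : 𝓢(Plane, Plane)) : Prop :=
  ∀ ξ, 𝓕 (complexify w) ξ ≠ 0 → 3 / 4 < ξ 0 ^ 2 ∧ ξ 0 ^ 2 < 5 / 4 ∧ ξ 1 ^ 2 < 1 / 4

theorem IsSpectrallyLocalized.mem_annulus {w : 𝓢(Plane, Plane)} (hw : IsSpectrallyLocalized w)
    (ξ : Plane) (hξ : 𝓕 (complexify w) ξ ≠ 0) : 2⁻¹ ≤ ‖ξ‖ ∧ ‖ξ‖ ≤ 2 := by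
  obtain ⟨h1, h2, h3⟩ := hw ξ hξ
  have hn : ‖ξ‖ ^ 2 = ξ 0 ^ 2 + ξ 1 ^ 2 := by
    rw [EuclideanSpace.norm_sq_eq, Fin.sum_univ_two]
    simp
  constructor
  · refine le_of_sq_le_sq ?_ (norm_nonneg ξ)
    nlinarith [sq_nonneg (ξ 1)]
  · refine le_of_sq_le_sq ?_ zero_le_two
    nlinarith

theorem IsSpectrallyLocalized.integral_rescale_mul_rescale {w : 𝓢(Plane, Plane)}
    (hw : IsSpectrallyLocalized w) {k l : ℤ} (hkl : k < l) (i j : Fin 2) :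
    ∫ x, rescale k w x i * rescale l w x j = 0 := by
  rw [← Complex.ofReal_eq_zero, integral_mul_eq_integral_fourier]
  refine integral_eq_zero_of_ae (Eventually.of_forall fun ξ => ?_)
  simp only [complexify_rescale, fourier_rescale]
  by_cases h1 : 𝓕 (complexify w) ((2 : ℝ) ^ (-k) • ξ) = 0
  · simp only [h1, smul_zero, PiLp.zero_apply, inner_zero_left, Pi.zero_apply]
  by_cases h2 : 𝓕 (complexify w) ((2 : ℝ) ^ (-l) • ξ) = 0
  · simp only [h2, smul_zero, PiLp.zero_apply, inner_zero_right, Pi.zero_apply]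
  exfalso
  have h3 := (hw _ h1).2.1
  have h4 := (hw _ h2).1
  rw [PiLp.smul_apply, smul_eq_mul, mul_pow] at h3 h4
  -- Distinct scales differ by a factor of at least $2$, so a common frequency would give
  -- $\frac34<\frac14\cdot\frac54$.
  have h5 : (2 : ℝ) ^ (-l) ≤ 2⁻¹ * (2 : ℝ) ^ (-k) := by
    rw [← zpow_neg_one, ← zpow_add₀ (by norm_num)]
    exact zpow_le_zpow_right₀ (by norm_num) (by omega)
  have h6 : ((2 : ℝ) ^ (-l)) ^ 2 ≤ (2⁻¹ * (2 : ℝ) ^ (-k)) ^ 2 := by gcongr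
  have h7 := mul_le_mul_of_nonneg_right h6 (sq_nonneg (ξ 0))
  nlinarith

theorem secondMoment_superposition {w : 𝓢(Plane, Plane)} (hw : IsSpectrallyLocalized w) (a : ℝ)
    (n : ℕ) (i j : Fin 2) :
    secondMoment (superposition w a n) i j = a ^ 2 * n * secondMoment w i j := by
  have hx : ∀ x, superposition w a n x i * superposition w a n x j =
      a ^ 2 * ∑ k ∈ Finset.range n, ∑ l ∈ Finset.range n,
        rescale (k : ℤ) w x i * rescale (l : ℤ) w x j := by
    intro x
    have hs : ∀ m, superposition w a n x m = a * ∑ k ∈ Finset.range n, rescale (k : ℤ) w x m := by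
      intro m
      simp [superposition]
    rw [hs, hs, ← Finset.sum_mul_sum]
    ring
  have hz : ∀ k l : ℕ, ∫ x, rescale (k : ℤ) w x i * rescale (l : ℤ) w x j =
      if k = l then secondMoment w i j else 0 := by
    intro k l
    rcases lt_trichotomy k l with h | h | h
    · rw [if_neg h.ne]
      exact hw.integral_rescale_mul_rescale (by exact_mod_cast h) i j
    · rw [if_pos h, h]
      exact secondMoment_rescale w l i j
    · rw [if_neg h.ne']
      simp only [mul_comm (rescale (k : ℤ) w _ i)]
      exact hw.integral_rescale_mul_rescale (by exact_mod_cast h) j i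
  rw [secondMoment]
  simp only [hx]
  rw [integral_const_mul, integral_finsetSum _ fun k _ => integrable_finsetSum _ fun l _ =>
    integrable_mul_coord _ _ _ _]
  simp only [integral_finsetSum _ fun (l : ℕ) _ => integrable_mul_coord _ (rescale (l : ℤ) w) _ _,
    hz]
  have hs : ∀ k ∈ Finset.range n,
      (∑ l ∈ Finset.range n, if k = l then secondMoment w i j else 0) = secondMoment w i j :=
    fun k hk => by rw [Finset.sum_ite_eq, if_pos hk]
  rw [Finset.sum_congr rfl hs, Finset.sum_const, Finset.card_range, nsmul_eq_mul, mul_assoc]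

/-! ### Divergence-free superpositions -/

theorem DivFree.rescale {w : 𝓢(Plane, Plane)} (hw : DivFree w) (k : ℤ) :
    DivFree (StationaryNS.rescale k w) := by
  intro x
  have h : ∀ m, fderiv ℝ (StationaryNS.rescale k w) x m =
      ((2 : ℝ) ^ k * (2 : ℝ) ^ k) • fderiv ℝ w ((2 : ℝ) ^ k • x) m := by
    intro m
    have h1 : HasFDerivAt (fun y : Plane => (2 : ℝ) ^ k • y)
      ((2 : ℝ) ^ k • ContinuousLinearMap.id ℝ Plane) x := (hasFDerivAt_id x).fun_const_smul _
    have h2 := ((w.hasFDerivAt ((2 : ℝ) ^ k • x)).comp x h1).const_smul ((2 : ℝ) ^ k)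
    have h3 : ⇑(StationaryNS.rescale k w) =
      (2 : ℝ) ^ k • (⇑w ∘ fun y : Plane => (2 : ℝ) ^ k • y) := rfl
    rw [h3, h2.fderiv]
    simp [smul_smul]
  simp only [h, PiLp.smul_apply, smul_eq_mul]
  rw [← Finset.mul_sum, hw, mul_zero]

theorem DivFree.superposition {w : 𝓢(Plane, Plane)} (hw : DivFree w) (a : ℝ) (n : ℕ) :
    DivFree (superposition w a n) := by
  intro x
  have h : ∀ m, fderiv ℝ (StationaryNS.superposition w a n) x m =
      a • ∑ k ∈ Finset.range n, fderiv ℝ (StationaryNS.rescale (k : ℤ) w) x m := by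
    intro m
    have h1 : HasFDerivAt (fun y => ∑ k ∈ Finset.range n, StationaryNS.rescale (k : ℤ) w y)
        (∑ k ∈ Finset.range n, fderiv ℝ (StationaryNS.rescale (k : ℤ) w) x) x :=
      HasFDerivAt.fun_sum fun k _ => SchwartzMap.hasFDerivAt _ x
    have h2 : ⇑(StationaryNS.superposition w a n) =
        a • fun y => ∑ k ∈ Finset.range n, StationaryNS.rescale (k : ℤ) w y := by
      ext1 y
      simp [StationaryNS.superposition]
    rw [h2, (h1.const_smul a).fderiv]
    simp
  simp only [h, PiLp.smul_apply, smul_eq_mul]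
  rw [← Finset.mul_sum]
  simp only [WithLp.ofLp_sum, Finset.sum_apply]
  rw [Finset.sum_comm, Finset.sum_eq_zero fun (k : ℕ) _ => hw.rescale (k : ℤ) x, mul_zero]

/-! ### Fields with a stream function -/

theorem postcompCLM_lineDerivOp {E F : Type*} [NormedAddCommGroup E] [NormedSpace ℝ E]
    [NormedAddCommGroup F] [NormedSpace ℝ F] (L : E →L[ℝ] F) (f : 𝓢(Plane, E)) (m : Plane) :
    (∂_{m} f).postcompCLM L = ∂_{m} (f.postcompCLM L) := by
  ext1 x
  have hd : HasFDerivAt (fun y => L (f y)) (L.comp (fderiv ℝ f x)) x :=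
    L.hasFDerivAt.comp x f.differentiableAt.hasFDerivAt
  have hc : ⇑(f.postcompCLM L) = fun y => L (f y) := rfl
  rw [SchwartzMap.lineDerivOp_apply_eq_fderiv, hc, hd.fderiv]
  rfl

theorem lineDerivOp_comm_schwartz {E : Type*} [NormedAddCommGroup E] [NormedSpace ℝ E]
    (f : 𝓢(Plane, E)) (m n : Plane) : ∂_{m} (∂_{n} f) = ∂_{n} (∂_{m} f) := by
  have h : ∀ (m n x : Plane), ∂_{m} (∂_{n} f) x = fderiv ℝ (fderiv ℝ f) x m n := by
    intro m n x
    have hd : DifferentiableAt ℝ (fderiv ℝ f) x :=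
      (SchwartzMap.fderivCLM ℝ Plane E f).differentiableAt
    have hc : ⇑(∂_{n} f : 𝓢(Plane, E)) = fun y => fderiv ℝ f y n :=
      funext fun y => SchwartzMap.lineDerivOp_apply_eq_fderiv n f y
    rw [SchwartzMap.lineDerivOp_apply_eq_fderiv, hc, fderiv_clm_apply hd (by fun_prop)]
    simp
  ext1 x
  rw [h, h]
  exact ((f.contDiffAt 2).isSymmSndFDerivAt (by simp)).eq m n

/-- The field `∇^⊥ ψ = (-∂₂ψ, ∂₁ψ)` with stream function `ψ`. -/
def perpGrad (ψ : 𝓢(Plane, ℝ)) : 𝓢(Plane, Plane) :=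
  (∂_{unitVec 0} ψ).postcompCLM (ContinuousLinearMap.toSpanSingleton ℝ (unitVec 1)) -
    (∂_{unitVec 1} ψ).postcompCLM (ContinuousLinearMap.toSpanSingleton ℝ (unitVec 0))

theorem perpGrad_coord_zero (ψ : 𝓢(Plane, ℝ)) :
    (perpGrad ψ).postcompCLM (EuclideanSpace.proj 0 : Plane →L[ℝ] ℝ) = -∂_{unitVec 1} ψ := by
  ext1 x
  simp [perpGrad]

theorem perpGrad_coord_one (ψ : 𝓢(Plane, ℝ)) :
    (perpGrad ψ).postcompCLM (EuclideanSpace.proj 1 : Plane →L[ℝ] ℝ) = ∂_{unitVec 0} ψ := by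
  ext1 x
  simp [perpGrad]

theorem divFree_perpGrad (ψ : 𝓢(Plane, ℝ)) : DivFree (perpGrad ψ) := by
  intro x
  have h : ∀ k, fderiv ℝ (perpGrad ψ) x (unitVec k) k =
      ∂_{unitVec k} ((perpGrad ψ).postcompCLM (EuclideanSpace.proj k : Plane →L[ℝ] ℝ)) x := by
    intro k
    rw [← postcompCLM_lineDerivOp, SchwartzMap.postcompCLM_apply,
      SchwartzMap.lineDerivOp_apply_eq_fderiv]
    rfl
  rw [Fin.sum_univ_two, h, h, perpGrad_coord_zero, perpGrad_coord_one,
    lineDerivOp_comm_schwartz ψ (unitVec 1) (unitVec 0), LineDeriv.lineDerivOp_neg]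
  simp

theorem fourier_lineDerivOp_apply (f : 𝓢(Plane, ℂ)) (k : Fin 2) (ξ : Plane) :
    𝓕 (∂_{unitVec k} f) ξ = 2 * Real.pi * Complex.I * ξ k * 𝓕 f ξ := by
  have hg : (fun ξ : Plane => inner ℝ ξ (unitVec k)).HasTemperateGrowth := by fun_prop
  rw [SchwartzMap.fourier_lineDerivOp_eq, smul_apply,
    SchwartzMap.smulLeftCLM_apply_apply hg]
  simp [EuclideanSpace.inner_single_right, mul_assoc]

theorem complexify_coord (u : 𝓢(Plane, Plane)) (k : Fin 2) :
    (complexify u).postcompCLM (EuclideanSpace.proj k : CVec →L[ℂ] ℂ) =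
      (u.postcompCLM (EuclideanSpace.proj k : Plane →L[ℝ] ℝ)).postcompCLM Complex.ofRealCLM :=
  rfl

theorem fourier_perpGrad_zero (ψ : 𝓢(Plane, ℝ)) (ξ : Plane) :
    𝓕 (complexify (perpGrad ψ)) ξ 0 =
      -(2 * Real.pi * Complex.I * ξ 1 * 𝓕 (ψ.postcompCLM Complex.ofRealCLM) ξ) := by
  rw [fourier_apply_coord, complexify_coord, perpGrad_coord_zero, map_neg,
    postcompCLM_lineDerivOp, FourierTransform.fourier_neg, neg_apply, fourier_lineDerivOp_apply]

theorem fourier_perpGrad_one (ψ : 𝓢(Plane, ℝ)) (ξ : Plane) :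
    𝓕 (complexify (perpGrad ψ)) ξ 1 =
      2 * Real.pi * Complex.I * ξ 0 * 𝓕 (ψ.postcompCLM Complex.ofRealCLM) ξ := by
  rw [fourier_apply_coord, complexify_coord, perpGrad_coord_one, postcompCLM_lineDerivOp,
    fourier_lineDerivOp_apply]

/-- An even real function is the Fourier transform of a real function. -/
theorem exists_real_fourier_eq {h : Plane → ℝ} (hs : HasCompactSupport h)
    (hd : ContDiff ℝ ((⊤ : ℕ∞) : WithTop ℕ∞) h) (heven : ∀ ξ, h (-ξ) = h ξ) :
    ∃ ψ : 𝓢(Plane, ℝ), ∀ ξ, 𝓕 (ψ.postcompCLM Complex.ofRealCLM) ξ = (h ξ : ℂ) := by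
  obtain ⟨f, hf⟩ : ∃ f : 𝓢(Plane, ℂ), f = bumpToSchwartz hs hd := ⟨_, rfl⟩
  have hfa : ∀ ξ, f ξ = (h ξ : ℂ) := fun ξ => by rw [hf, bumpToSchwartz_apply]
  have hreal : ∀ x, (starRingEnd ℂ) (𝓕⁻ f x) = 𝓕⁻ f x := by
    intro x
    -- Conjugation reverses the sign of the phase, and the substitution $\xi\mapsto-\xi$ restores it
    -- because $h$ is real and even.
    rw [SchwartzMap.fourierInv_coe, Real.fourierInv_eq, ← integral_conj,
      ← integral_neg_eq_self (μ := (volume : Measure Plane))]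
    refine integral_congr_ae (Eventually.of_forall fun ξ => ?_)
    simp only [hfa, heven, Circle.smul_def, smul_eq_mul, map_mul, Complex.conj_ofReal,
      inner_neg_left]
    congr 1
    rw [AddChar.map_neg_eq_inv, Circle.coe_inv_eq_conj, Complex.conj_conj]
  refine ⟨(𝓕⁻ f).postcompCLM Complex.reCLM, fun ξ => ?_⟩
  have h1 : ((𝓕⁻ f).postcompCLM Complex.reCLM).postcompCLM Complex.ofRealCLM = 𝓕⁻ f := by
    ext1 x
    exact Complex.conj_eq_iff_re.1 (hreal x)
  rw [h1, FourierTransform.fourier_fourierInv_eq, hfa]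

/-! ### The profile -/

/-- A bump on the real line around `1`. -/
def bumpOne : ContDiffBump (1 : ℝ) := ⟨1 / 8, 1 / 4, by norm_num, by norm_num⟩

/-- A bump on the real line around `0`. -/
def bumpZero : ContDiffBump (0 : ℝ) := ⟨1 / 8, 1 / 4, by norm_num, by norm_num⟩

/-- The Fourier transform of the stream function of the profile. -/
def streamSymbol (ξ : Plane) : ℝ := bumpOne (ξ 0 ^ 2) * bumpZero (ξ 1 ^ 2)

theorem streamSymbol_support {ξ : Plane} (h : streamSymbol ξ ≠ 0) :
    3 / 4 < ξ 0 ^ 2 ∧ ξ 0 ^ 2 < 5 / 4 ∧ ξ 1 ^ 2 < 1 / 4 := by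
  obtain ⟨h1, h2⟩ := mul_ne_zero_iff.1 h
  have h3 : ξ 0 ^ 2 ∈ Metric.ball (1 : ℝ) (1 / 4) := by
    have h3 := bumpOne.support_eq
    exact h3 ▸ h1
  have h4 : ξ 1 ^ 2 ∈ Metric.ball (0 : ℝ) (1 / 4) := by
    have h4 := bumpZero.support_eq
    exact h4 ▸ h2
  rw [Metric.mem_ball, Real.dist_eq, abs_lt] at h3 h4
  refine ⟨?_, ?_, ?_⟩ <;> linarith

theorem contDiff_streamSymbol : ContDiff ℝ ((⊤ : ℕ∞) : WithTop ℕ∞) streamSymbol :=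
  (bumpOne.contDiff.comp ((contDiff_coord 0).pow 2)).mul
    (bumpZero.contDiff.comp ((contDiff_coord 1).pow 2))

theorem hasCompactSupport_streamSymbol : HasCompactSupport streamSymbol := by
  refine HasCompactSupport.intro (isCompact_closedBall (0 : Plane) 2) fun ξ hξ => ?_
  by_contra h
  obtain ⟨h1, h2, h3⟩ := streamSymbol_support h
  refine hξ ?_
  rw [mem_closedBall_zero_iff]
  refine le_of_sq_le_sq ?_ zero_le_two
  rw [EuclideanSpace.norm_sq_eq, Fin.sum_univ_two]
  simp only [Real.norm_eq_abs, sq_abs]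
  linarith

/-- The reflection `(ξ₁, ξ₂) ↦ (-ξ₁, ξ₂)`. -/
def reflection : Plane ≃ₗᵢ[ℝ] Plane :=
  LinearIsometryEquiv.piLpCongrRight 2 fun k : Fin 2 =>
    if k = 0 then LinearIsometryEquiv.neg ℝ else LinearIsometryEquiv.refl ℝ ℝ

theorem integral_eq_zero_of_reflection {f : Plane → ℝ} (hf : ∀ ξ, f (reflection ξ) = -f ξ) :
    ∫ ξ, f ξ = 0 := by
  have h := reflection.measurePreserving.integral_comp
    reflection.toHomeomorph.measurableEmbedding f
  simp only [hf, integral_neg] at h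
  linarith

/-- There is a divergence-free field with localized spectrum and anisotropic second moments. -/
theorem exists_profile : ∃ w : 𝓢(Plane, Plane), DivFree w ∧ IsSpectrallyLocalized w ∧
    secondMoment w 0 1 = 0 ∧ secondMoment w 0 0 ≠ secondMoment w 1 1 := by
  -- The symbol depends only on the squares of the coordinates. Evenness under $\xi\mapsto-\xi$
  -- makes the stream function real; evenness in $\xi_1$ alone removes the mixed moment below.
  obtain ⟨ψ, hψ⟩ := exists_real_fourier_eq hasCompactSupport_streamSymbol contDiff_streamSymbol
    fun ξ => by simp [streamSymbol]
  have h0 := fourier_perpGrad_zero ψ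
  have h1 := fourier_perpGrad_one ψ
  simp only [hψ] at h0 h1
  have hm : ∀ i j, ∀ g : Plane → ℝ, (∀ ξ, inner ℂ (𝓕 (complexify (perpGrad ψ)) ξ i)
      (𝓕 (complexify (perpGrad ψ)) ξ j) = ((4 * Real.pi ^ 2 * g ξ : ℝ) : ℂ)) →
      secondMoment (perpGrad ψ) i j = 4 * Real.pi ^ 2 * ∫ ξ, g ξ := by
    intro i j g hg
    rw [← Complex.ofReal_inj, secondMoment, integral_mul_eq_integral_fourier]
    simp only [hg]
    rw [integral_complex_ofReal, integral_const_mul]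
  have hc : Continuous streamSymbol := contDiff_streamSymbol.continuous
  have hcoord : ∀ k : Fin 2, Continuous fun ξ : Plane => ξ k := fun k =>
    (contDiff_coord k).continuous
  have hint : ∀ k : Fin 2, Integrable (fun ξ : Plane => (streamSymbol ξ * ξ k) ^ 2) volume := by
    intro k
    refine Continuous.integrable_of_hasCompactSupport ((hc.mul (hcoord k)).pow 2) ?_
    exact (hasCompactSupport_streamSymbol.mul_right).comp_left (g := fun x : ℝ => x ^ 2) (by simp)
  refine ⟨perpGrad ψ, divFree_perpGrad ψ, fun ξ hξ => ?_, ?_, ?_⟩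
  · refine streamSymbol_support fun h => hξ ?_
    ext k
    fin_cases k
    · simpa [h] using h0 ξ
    · simpa [h] using h1 ξ
  · rw [hm 0 1 (fun ξ => -(streamSymbol ξ ^ 2 * ξ 0 * ξ 1)), integral_eq_zero_of_reflection,
      mul_zero]
    · intro ξ
      have e0 : reflection ξ 0 = -ξ 0 := rfl
      have e1 : reflection ξ 1 = ξ 1 := rfl
      simp only [streamSymbol, e0, e1, neg_sq]
      ring
    · intro ξ
      rw [h0, h1]
      simp only [RCLike.inner_apply, map_mul, map_neg, Complex.conj_ofReal, Complex.conj_I,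
        map_ofNat]
      push_cast
      linear_combination (4 * Real.pi ^ 2 * ξ 0 * ξ 1 * streamSymbol ξ ^ 2 : ℂ) * Complex.I_sq
  · have e0 := hm 0 0 (fun ξ => (streamSymbol ξ * ξ 1) ^ 2) fun ξ => by
      rw [h0]
      simp only [RCLike.inner_apply, map_mul, map_neg, Complex.conj_ofReal, Complex.conj_I,
        map_ofNat]
      push_cast
      linear_combination (-4 * Real.pi ^ 2 * ξ 1 ^ 2 * streamSymbol ξ ^ 2 : ℂ) * Complex.I_sq
    have e1 := hm 1 1 (fun ξ => (streamSymbol ξ * ξ 0) ^ 2) fun ξ => by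
      rw [h1]
      simp only [RCLike.inner_apply, map_mul, Complex.conj_ofReal, Complex.conj_I,
        map_ofNat]
      push_cast
      linear_combination (-4 * Real.pi ^ 2 * ξ 0 ^ 2 * streamSymbol ξ ^ 2 : ℂ) * Complex.I_sq
    -- On the support $\xi_1^2>\frac34>\frac14>\xi_2^2$, so the integrand is nonnegative; it equals
    -- $1$ at $e_1$.
    have hpos : 0 < ∫ ξ : Plane, ((streamSymbol ξ * ξ 0) ^ 2 - (streamSymbol ξ * ξ 1) ^ 2) := by
      refine Continuous.integral_pos_of_hasCompactSupport_nonneg_nonzero (x := unitVec 0)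
        (((hc.mul (hcoord 0)).pow 2).sub ((hc.mul (hcoord 1)).pow 2)) ?_ (fun ξ => ?_) ?_
      · refine HasCompactSupport.mono hasCompactSupport_streamSymbol fun ξ hξ h => hξ ?_
        simp [h]
      · by_cases h : streamSymbol ξ = 0
        · simp [h]
        · obtain ⟨h2, -, h3⟩ := streamSymbol_support h
          have : 0 ≤ streamSymbol ξ ^ 2 * (ξ 0 ^ 2 - ξ 1 ^ 2) :=
            mul_nonneg (sq_nonneg _) (by linarith)
          simp only [Pi.zero_apply]
          linarith
      · have hb1 : bumpOne 1 = 1 := bumpOne.one_of_mem_closedBall (by simp [bumpOne])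
        have hb0 : bumpZero 0 = 1 := bumpZero.one_of_mem_closedBall (by simp [bumpZero])
        simp [streamSymbol, hb1, hb0]
    rw [integral_sub (hint 0) (hint 1)] at hpos
    intro h
    rw [e0, e1] at h
    have := mul_left_cancel₀ (by positivity) h
    linarith

/-! ### Norm inflation -/

theorem tendsto_enorm_mul_zero {a : ℕ → ℝ} (ha : Tendsto a atTop (𝓝 0)) {B : ℝ≥0∞} (hB : B < ∞) :
    Tendsto (fun N => ‖a N‖ₑ * B) atTop (𝓝 0) := by
  have h := ENNReal.Tendsto.mul_const (b := B) ha.enorm (Or.inr hB.ne)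
  simpa using h

/-- For `q < ∞` the low frequencies of the bilinear term make its norm infinite, however small the
multiple of a fixed field. -/
theorem exists_inflation_of_lt_top {χ : Plane → ℝ} (hχ : IsLittlewoodPaley χ) {p q : ℝ≥0∞}
    (hp : 1 ≤ p) (hq : 1 ≤ q) (hq' : q < ∞) :
    ∃ u : ℕ → 𝓢(Plane, Plane), (∀ N, DivFree (u N)) ∧
      (∀ N, critNorm χ p q (toDist (u N)) < ∞) ∧
      Tendsto (fun N => critNorm χ p q (toDist (u N))) atTop (𝓝 0) ∧
      0 < liminf (fun N => critNorm χ p q (bilinearTerm (u N) (u N))) atTop := by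
  obtain ⟨w, hdiv, hw, h01, hne⟩ := exists_profile
  obtain ⟨κ, hκ, hlow⟩ := exists_lowFrequency_lower_bound hχ hp
  have hq0 : 0 < q.toReal := ENNReal.toReal_pos (by positivity) hq'.ne
  have hB : (∑' i, blockNorm χ p (complexify w) i ^ q.toReal) ^ (1 / q.toReal) < ∞ :=
    ENNReal.rpow_lt_top_of_nonneg (by positivity)
      (tsum_blockNorm_rpow_lt_top hχ p hw.mem_annulus hq0).ne
  have hle : ∀ N : ℕ, critNorm χ p q (toDist (superposition w (1 / ((N : ℝ) + 1)) 1)) ≤ _ :=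
    fun N => critNorm_smul_le hχ hp hq hq' w _
  refine ⟨fun N => superposition w (1 / ((N : ℝ) + 1)) 1, fun N => hdiv.superposition _ _,
    fun N => (hle N).trans_lt (ENNReal.mul_lt_top enorm_lt_top hB), ?_, ?_⟩
  · exact tendsto_of_tendsto_of_tendsto_of_le_of_le tendsto_const_nhds
      (tendsto_enorm_mul_zero tendsto_one_div_add_atTop_nhds_zero_nat hB)
      (fun _ => bot_le) hle
  · have htop : ∀ N : ℕ, critNorm χ p q (bilinearTerm (superposition w (1 / ((N : ℝ) + 1)) 1)
        (superposition w (1 / ((N : ℝ) + 1)) 1)) = ∞ := by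
      intro N
      have hN : (1 / ((N : ℝ) + 1)) ^ 2 * (1 : ℕ) ≠ 0 := by positivity
      have hne' : secondMoment (superposition w (1 / ((N : ℝ) + 1)) 1) 0 0 ≠
          secondMoment (superposition w (1 / ((N : ℝ) + 1)) 1) 1 1 := by
        rw [secondMoment_superposition hw, secondMoment_superposition hw]
        exact fun h => hne (mul_left_cancel₀ hN h)
      refine critNorm_eq_top hq hq' ?_ (hlow _ ?_ hne')
      · exact mul_ne_zero hκ (enorm_ne_zero.2 (sub_ne_zero.2 hne'))
      · rw [secondMoment_superposition hw, h01, mul_zero]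
    -- The norm is infinite for every `N`, hence so is the lower limit.
    simp only [htop]
    simp

/-- For `q = ∞` a single sequence is small in the critical spaces of all integrabilities `p`, while
its second moments are fixed. -/
theorem exists_inflation_top {χ : Plane → ℝ} (hχ : IsLittlewoodPaley χ) :
    ∃ u : ℕ → 𝓢(Plane, Plane), (∀ N, DivFree (u N)) ∧ ∀ p : ℝ≥0∞, 1 ≤ p →
      (∀ N, critNorm χ p ∞ (toDist (u N)) < ∞) ∧
      Tendsto (fun N => critNorm χ p ∞ (toDist (u N))) atTop (𝓝 0) ∧
      0 < liminf (fun N => critNorm χ p ∞ (bilinearTerm (u N) (u N))) atTop := by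
  obtain ⟨w, hdiv, hw, h01, hne⟩ := exists_profile
  -- With `N + 1` copies, the amplitude $(N+1)^{-1/2}$ is the one that keeps the second moments
  -- equal to those of $w$.
  obtain ⟨a, ha⟩ : ∃ a : ℕ → ℝ, ∀ N, a N = √(1 / ((N : ℝ) + 1)) := ⟨_, fun _ => rfl⟩
  have ha0 : Tendsto a atTop (𝓝 0) := by
    rw [funext ha, ← Real.sqrt_zero]
    exact (Real.continuous_sqrt.tendsto 0).comp tendsto_one_div_add_atTop_nhds_zero_nat
  have ha1 : ∀ N, a N ^ 2 * ((N + 1 : ℕ) : ℝ) = 1 := by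
    intro N
    rw [ha, Real.sq_sqrt (by positivity)]
    push_cast
    field_simp
  have hmom : ∀ N i j, secondMoment (superposition w (a N) (N + 1)) i j = secondMoment w i j := by
    intro N i j
    rw [secondMoment_superposition hw, ha1, one_mul]
  refine ⟨fun N => superposition w (a N) (N + 1), fun N => hdiv.superposition _ _,
    fun p hp => ?_⟩
  obtain ⟨κ, hκ, hlow⟩ := exists_lowFrequency_lower_bound hχ hp
  have hB : ∑' i, blockNorm χ p (complexify w) i < ∞ := by
    simpa using tsum_blockNorm_rpow_lt_top hχ p hw.mem_annulus one_pos
  have hle : ∀ N : ℕ, critNorm χ p ∞ (toDist (superposition w (a N) (N + 1))) ≤ _ :=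
    fun N => critNorm_top_superposition_le hχ hp w _ _
  refine ⟨fun N => (hle N).trans_lt (ENNReal.mul_lt_top enorm_lt_top hB), ?_, ?_⟩
  · exact tendsto_of_tendsto_of_tendsto_of_le_of_le tendsto_const_nhds
      (tendsto_enorm_mul_zero ha0 hB) (fun _ => bot_le) hle
  · refine lt_of_lt_of_le (b := κ * ‖secondMoment w 0 0 - secondMoment w 1 1‖ₑ) ?_
      (le_liminf_of_le (by isBoundedDefault) (Eventually.of_forall fun N => ?_))
    · exact pos_iff_ne_zero.2 (mul_ne_zero hκ (enorm_ne_zero.2 (sub_ne_zero.2 hne)))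
    · have h := hlow (superposition w (a N) (N + 1)) (by rw [hmom, h01])
        (by rw [hmom, hmom]; exact hne)
      rw [hmom, hmom] at h
      exact le_critNorm_top h

theorem not_exists_bilinear_bound {χ : Plane → ℝ} {p q : ℝ≥0∞} {u : ℕ → 𝓢(Plane, Plane)}
    (hdiv : ∀ N, DivFree (u N)) (hfin : ∀ N, critNorm χ p q (toDist (u N)) < ∞)
    (hlim : Tendsto (fun N => critNorm χ p q (toDist (u N))) atTop (𝓝 0))
    (hpos : 0 < liminf (fun N => critNorm χ p q (bilinearTerm (u N) (u N))) atTop) :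
    ¬ ∃ C : ℝ≥0, ∀ u v : 𝓢(Plane, Plane), DivFree u → DivFree v →
      critNorm χ p q (toDist u) < ∞ → critNorm χ p q (toDist v) < ∞ →
      critNorm χ p q (bilinearTerm u v) ≤
        C * critNorm χ p q (toDist u) * critNorm χ p q (toDist v) := by
  rintro ⟨C, hC⟩
  have h1 : Tendsto (fun N => C * critNorm χ p q (toDist (u N)) * critNorm χ p q (toDist (u N)))
      atTop (𝓝 0) := by
    have h2 := ENNReal.Tendsto.const_mul (a := (C : ℝ≥0∞)) hlim (Or.inr ENNReal.coe_ne_top)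
    rw [mul_zero] at h2
    have h3 := ENNReal.Tendsto.mul h2 (Or.inr ENNReal.zero_ne_top) hlim (Or.inr ENNReal.zero_ne_top)
    rwa [mul_zero] at h3
  have h4 := tendsto_of_tendsto_of_tendsto_of_le_of_le tendsto_const_nhds h1
    (fun _ => bot_le) fun N => hC (u N) (u N) (hdiv N) (hdiv N) (hfin N) (hfin N)
  exact hpos.ne' h4.liminf_eq

end StationaryNS

end

theorem theorem1 (χ : Plane → ℝ) (hχ : IsLittlewoodPaley χ) :
    (∀ p q : ℝ≥0∞, 1 ≤ p → ((1 ≤ q ∧ q < ∞) ∨ (2 ≤ p ∧ q = ∞)) →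
      (∃ u : ℕ → 𝓢(Plane, Plane),
        (∀ N, DivFree (u N)) ∧
        (∀ N, critNorm χ p q (toDist (u N)) < ∞) ∧
        Tendsto (fun N => critNorm χ p q (toDist (u N)))
          atTop (𝓝 0) ∧
        0 < liminf (fun N =>
          critNorm χ p q (bilinearTerm (u N) (u N))) atTop) ∧
      ¬ ∃ C : ℝ≥0, ∀ u v : 𝓢(Plane, Plane),
        DivFree u → DivFree v →
        critNorm χ p q (toDist u) < ∞ →
        critNorm χ p q (toDist v) < ∞ →
        critNorm χ p q (bilinearTerm u v) ≤
          C * critNorm χ p q (toDist u) *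
            critNorm χ p q (toDist v)) ∧
    (∀ p p' : ℝ≥0∞, 1 ≤ p → p < 2 → p⁻¹ + p'⁻¹ = 1 →
      ∃ u v : ℕ → 𝓢(Plane, Plane),
        (∀ N, DivFree (u N)) ∧
        (∀ N, DivFree (v N)) ∧
        (∀ N, critNorm χ p ∞ (toDist (u N)) < ∞) ∧
        (∀ N, critNorm χ p' ∞ (toDist (v N)) < ∞) ∧
        Tendsto (fun N => critNorm χ p ∞ (toDist (u N)))
          atTop (𝓝 0) ∧
        Tendsto (fun N => critNorm χ p' ∞ (toDist (v N)))
          atTop (𝓝 0) ∧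
        0 < liminf (fun N =>
          critNorm χ p ∞ (bilinearTerm (u N) (v N))) atTop) := by

  refine ⟨fun p q hp hpq => ?_, fun p p' hp _ hpp' => ?_⟩
  · obtain ⟨u, hdiv, hfin, hlim, hpos⟩ : ∃ u : ℕ → 𝓢(Plane, Plane), (∀ N, DivFree (u N)) ∧
        (∀ N, critNorm χ p q (toDist (u N)) < ∞) ∧
        Tendsto (fun N => critNorm χ p q (toDist (u N))) atTop (𝓝 0) ∧
        0 < liminf (fun N => critNorm χ p q (bilinearTerm (u N) (u N))) atTop := by
      rcases hpq with ⟨hq, hq'⟩ | ⟨-, rfl⟩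
      · exact exists_inflation_of_lt_top hχ hp hq hq'
      · obtain ⟨u, hdiv, h⟩ := exists_inflation_top hχ
        exact ⟨u, hdiv, h p hp⟩
    exact ⟨⟨u, hdiv, hfin, hlim, hpos⟩, not_exists_bilinear_bound hdiv hfin hlim hpos⟩
  · obtain ⟨u, hdiv, h⟩ := exists_inflation_top hχ
    have hp' : 1 ≤ p' := ENNReal.inv_le_one.1 (hpp' ▸ le_add_self)
    -- One sequence serves as both factors: it is small in the critical spaces for $p$ and for $p'$
    -- simultaneously.
    exact ⟨u, u, hdiv, hdiv, (h p hp).1, (h p' hp').1, (h p hp).2.1, (h p' hp').2.1, (h p hp).2.2⟩
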